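/- Let $p\ge 3$ be an integer. For $\beta\ge 0$ and $n\ge1$ let $\mathbb P_{\beta,p}$ be the $p$-tensor Curie-Weiss model on $\{-1,1\}^n$, with probability mass function proportional to $\exp\{\beta n^{1-p}\sum_{1\le i_1,\dots,i_p\le n}x_{i_1}\cdots x_{i_p}\}$. Put $I(x)=\frac12\{(1+x)\log(1+x)+(1-x)\log(1-x)\}$ and $H_{\beta,p}(x)=\beta x^p-I(x)$ for $x\in[-1,1]$, and $\beta^*(p)=\sup\{\beta\ge0:\sup_{[-1,1]}H_{\beta,p}=0\}$. Let $\hat\beta_{ML}\in[0,\infty]$ be the maximum likelihood estimator of $\beta\ge 0$ (equal to $+\infty$ if the likelihood has no maximizer), and let $\hat\beta_{MPL}$ be the maximum pseudolikelihood estimator, given by $\hat\beta_{MPL}=p^{-1}\bar X^{1-p}\tanh^{-1}(\bar X)$ if $\bar X=\frac1n\sum_i X_i\ne0$ and $\hat\beta_{MPL}=0$ if $\bar X=0$ (with $\tanh^{-1}(\pm1)=\pm\infty$). For an estimator $\hat\beta$ and a null value $\beta_0>\beta^*(p)$ let $T_n=\sqrt n(\hat\beta-\beta_0)$ and let $L_n=1-F_{T_n,\beta_0}(T_n)$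 be the $p$-value, where $F_{T_n,\beta_0}$ is the distribution function of $T_n$ under $\mathbb P_{\beta_0,p}$. The (weak) Bahadur slope of $\hat\beta$ at $\beta$ is the number $c(\beta_0,\beta,p)$ with $\frac1n\log L_n\to-\frac12c(\beta_0,\beta,p)$ in $\mathbb P_{\beta,p}$-probability as $n\to\infty$. Let $N^*(\beta_0,\beta,\delta,p)=-2\log(\delta)/c(\beta_0,\beta,p)$ be the asymptotic optimal sample size at level $\delta\in(0,1)$, and let $\mathrm{eff}(\hat\beta_{ML},\hat\beta_{MPL};\beta_0,\beta)=c_{ML}(\beta_0,\beta,p)/c_{MPL}(\beta_0,\beta,p)$ be the Bahadur asymptotic relative efficiency (considered only where $c_{MPL}>0$). Fix $\beta>\beta^*(p)$. Then $H_{\beta,p}$ has a unique positive global maximizer $m_*(\beta,p)$ on $[-1,1]$, both Bahadur slopes at $\beta$ exist for every $\beta_0>\beta^*(p)$, and both are positive if $\beta_0<\beta$. The set of all $\beta_0>\beta^*(p)$ with $\mathrm{eff}(\hat\beta_{ML},\hat\beta_{MPL};\beta_0,\beta)>1$ is $$\left(\beta^*(p),\ \frac{I(m_*(\beta,p))}{m_*(\beta,p)^p}\right).$$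 Further, $H_{\beta^*(p),p}(m_*(\beta,p))<0$ and, for every $\delta\in(0,1)$, $$\lim_{\beta_0\to\beta^*(p)^+}N^*_{MPL}(\beta_0,\beta,\delta,p)=\infty,\qquad \lim_{\beta_0\to\beta^*(p)^+}N^*_{ML}(\beta_0,\beta,\delta,p)=\frac{\log\delta}{H_{\beta^*(p),p}(m_*(\beta,p))}<\infty,$$ and hence $\lim_{\beta_0\to\beta^*(p)^+}\mathrm{eff}(\hat\beta_{ML},\hat\beta_{MPL};\beta_0,\beta)=\infty$. -/

import Mathlib

open Filter Topology Set

noncomputable section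

namespace CurieWeiss

/-! The `p`-tensor Curie-Weiss model on `{-1,1}^n`. The two spins are the units of `ℤ`. -/

/-- The spin configurations of size `n`. -/
abbrev Config (n : ℕ) : Type := Fin n → ℤˣ

/-- The sufficient statistic `n^{1-p} ∑_{i_1,…,i_p} x_{i_1} ⋯ x_{i_p}`. -/
def suffStat (p n : ℕ) (x : Config n) : ℝ :=
  (n : ℝ) ^ (1 - (p : ℤ)) * ∑ i : Fin p → Fin n, ∏ k : Fin p, (((x (i k) : ℤˣ) : ℤ) : ℝ)

/-- The probability mass function of the model with parameter `β`. -/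
def pmf (p : ℕ) (β : ℝ) (n : ℕ) (x : Config n) : ℝ :=
  Real.exp (β * suffStat p n x) / ∑ y : Config n, Real.exp (β * suffStat p n y)

/-- The probability of an event in the model with parameter `β`. -/
def prob (p : ℕ) (β : ℝ) (n : ℕ) (A : Set (Config n)) : ℝ :=
  ∑ x : Config n, A.indicator (pmf p β n) x

/-- The average magnetization `n⁻¹ ∑ x_i`. -/
def avgMag (n : ℕ) (x : Config n) : ℝ :=
  (∑ i : Fin n, (((x i : ℤˣ) : ℤ) : ℝ)) / n

/-! ### Estimators -/

/-- An estimator based on samples of every size; it may take the values `±∞`. -/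
abbrev Estimator : Type := ∀ n : ℕ, Config n → EReal

/-- The inverse hyperbolic tangent on `[-1,1]`, with the values `±∞` at `±1`. -/
def artanhExt (t : ℝ) : EReal :=
  if t = 1 then ⊤ else if t = -1 then ⊥ else (Real.artanh t : EReal)

/-- `η_p(t) = p⁻¹ t^{1-p} tanh⁻¹(t)` for `t ≠ 0`, and `η_p(0) = 0`. -/
def eta (p : ℕ) (t : ℝ) : EReal :=
  if t = 0 then 0 else (((p : ℝ)⁻¹ * t ^ (1 - (p : ℤ)) : ℝ) : EReal) * artanhExt t

/-- The maximum pseudolikelihood estimator. -/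
def mple (p : ℕ) : Estimator := fun n x => eta p (avgMag n x)

/-- `b` is a maximum likelihood estimate of the parameter in `[0,∞)` from the observation `x`:
it maximizes the likelihood, and it is `+∞` if the likelihood has no maximizer. -/
def IsMLE (p n : ℕ) (x : Config n) (b : EReal) : Prop :=
  (∃ t : ℝ, b = (t : EReal) ∧ 0 ≤ t ∧ IsMaxOn (fun s : ℝ => pmf p s n x) (Ici 0) t) ∨
    (b = ⊤ ∧ ¬ ∃ t : ℝ, 0 ≤ t ∧ IsMaxOn (fun s : ℝ => pmf p s n x) (Ici 0) t)

/-! ### Bahadur slopes -/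

/-- The test statistic `T_n = √n (β̂ - β₀)`; large values are significant. -/
def testStat (est : Estimator) (β₀ : ℝ) (n : ℕ) (x : Config n) : EReal :=
  (Real.sqrt n : EReal) * (est n x - (β₀ : EReal))

/-- The `p`-value `L_n = 1 - F(T_n)`, where `F` is the distribution function of `T_n` under the
null parameter `β₀`. -/
def pValue (p : ℕ) (est : Estimator) (β₀ : ℝ) (n : ℕ) (x : Config n) : ℝ :=
  prob p β₀ n {y | testStat est β₀ n x < testStat est β₀ n y}

/-- `c` is the (weak) Bahadur slope, at the alternative `β`, of the test of the null `β₀` based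
on `est`: `n⁻¹ log L_n → -c/2` in probability under `β` (where `log 0 = -∞`). -/
def IsBahadurSlope (p : ℕ) (est : Estimator) (β₀ β c : ℝ) : Prop :=
  ∀ ε : ℝ, 0 < ε →
    Tendsto (fun n : ℕ => prob p β n
      {x | 0 < pValue p est β₀ n x ∧ |Real.log (pValue p est β₀ n x) / n + c / 2| < ε})
      atTop (𝓝 1)

/-- The asymptotic sample size for significance at level `δ` of a test with slope `c`. -/
def asympSampleSize (δ c : ℝ) : ℝ := -2 * Real.log δ / c

/-- The Bahadur asymptotic relative efficiency of tests with slopes `c₁` and `c₂`. -/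
def bahadurARE (c₁ c₂ : ℝ) : ℝ := c₁ / c₂

/-! ### The function `H` and its maximizer -/

/-- `I(x) = ((1+x) log(1+x) + (1-x) log(1-x)) / 2`. -/
def entropyI (x : ℝ) : ℝ :=
  ((1 + x) * Real.log (1 + x) + (1 - x) * Real.log (1 - x)) / 2

/-- `H_{β,p}(x) = β x^p - I(x)`, considered on `[-1,1]`. -/
def hFun (p : ℕ) (β x : ℝ) : ℝ := β * x ^ p - entropyI x

/-- The threshold `β*(p)`. -/
def betaStar (p : ℕ) : ℝ :=
  sSup {β : ℝ | 0 ≤ β ∧ sSup (hFun p β '' Icc (-1) 1) = 0}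

/-- The set of positive global maximizers of `H_{β,p}` on `[-1,1]`. -/
def posMaximizers (p : ℕ) (β : ℝ) : Set ℝ :=
  {x | x ∈ Ioc (0 : ℝ) 1 ∧ IsMaxOn (hFun p β) (Icc (-1) 1) x}

end CurieWeiss

end

noncomputable section

namespace CurieWeiss

/-! On `(0,1)` the derivative of `hFun p b` is `(b - etaReal p t) * (p * t ^ (p - 1))`, and `etaReal
p` falls to a turning point `c` and then rises, unbounded at both ends. So for `b` above the
threshold `H_b` has one positive maximizer, the solution of `etaReal p m = b` to the right of `c`
(`exists_isMagnetization`), and `m` increases with `b`.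

Binomial coefficients are exponentials of `-entropyI` up to a factor `n + 1`. Hence the
magnetization lies in a set `B` with probability about `exp (n (sup_B H_b - H_b m))`
(`eventually_prob_le`, `eventually_le_prob`), and under `β` it concentrates near `m`, up to sign
when `p` is even (`tendsto_prob_nearMag`). A slope is therefore found by maximizing `H_{β₀}` over
the magnetizations at which the estimator exceeds its observed value (`isBahadurSlope_of_rate`).

Write `m₀` for the maximizer at `β₀`. The MLE is monotone in the sufficient statistic, so it rejects
for magnetizations beyond `m`, and its slope is `2 (H_{β₀} m₀ - H_{β₀} (max m m₀))`. The
pseudolikelihood estimator is large near magnetization `0` too, where `H_{β₀}` is close to `0`; its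
slope is the same with `H_{β₀} (max m m₀)` replaced by its maximum with `0`.

Where the MPL slope is positive, the two slopes thus differ exactly when `H_{β₀} m < 0`, that is `β₀
< I(m) / m ^ p`. As `β₀` decreases to the threshold, `H_{β₀} m₀` tends to `0` while `H_{β₀} m` stays
negative: the MPL slope vanishes and the ML slope does not. -/

/-! ### Calculus of the entropy and of `H`. -/

lemma hasDerivAt_artanh {t : ℝ} (ht : t ∈ Ioo (-1 : ℝ) 1) :
    HasDerivAt Real.artanh (1 / (1 - t ^ 2)) t := by
  have h1 : 0 < 1 + t := by linarith [ht.1]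
  have h2 : 0 < 1 - t := by linarith [ht.2]
  have hd : HasDerivAt (fun x : ℝ => (Real.log (1 + x) - Real.log (1 - x)) / 2)
      ((1 / (1 + t) - (-1) / (1 - t)) / 2) t :=
    ((((hasDerivAt_id t).const_add 1).log h1.ne').sub
      (((hasDerivAt_id t).const_sub 1).log h2.ne')).div_const 2
  have he : Real.artanh =ᶠ[𝓝 t] fun x : ℝ => (Real.log (1 + x) - Real.log (1 - x)) / 2 := by
    filter_upwards [Ioo_mem_nhds ht.1 ht.2] with x hx
    rw [Real.artanh_eq_half_log ⟨hx.1.le, hx.2.le⟩,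
      Real.log_div (by linarith [hx.1]) (by linarith [hx.2])]
    ring
  refine (hd.congr_of_eventuallyEq he).congr_deriv ?_
  have h3 : 1 - t ^ 2 ≠ 0 := by nlinarith
  field_simp
  ring

lemma continuous_entropyI : Continuous entropyI := by
  have h := Real.continuous_mul_log
  exact ((h.comp (continuous_const.add continuous_id)).add
    (h.comp (continuous_const.sub continuous_id))).div_const 2

lemma entropyI_zero : entropyI 0 = 0 := by simp [entropyI]

lemma entropyI_neg (t : ℝ) : entropyI (-t) = entropyI t := by
  unfold entropyI
  rw [sub_neg_eq_add, ← sub_eq_add_neg]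
  ring

lemma entropyI_abs (t : ℝ) : entropyI |t| = entropyI t := by
  rcases abs_choice t with h | h <;> rw [h]
  exact entropyI_neg t

lemma hasDerivAt_entropyI {t : ℝ} (ht : t ∈ Ioo (-1 : ℝ) 1) :
    HasDerivAt entropyI (Real.artanh t) t := by
  have h1 : 0 < 1 + t := by linarith [ht.1]
  have h2 : 0 < 1 - t := by linarith [ht.2]
  have ha : HasDerivAt (fun x : ℝ => (1 + x) * Real.log (1 + x))
      (1 * Real.log (1 + t) + (1 + t) * (1 / (1 + t))) t :=
    ((hasDerivAt_id t).const_add 1).mul (((hasDerivAt_id t).const_add 1).log h1.ne')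
  have hb : HasDerivAt (fun x : ℝ => (1 - x) * Real.log (1 - x))
      ((-1) * Real.log (1 - t) + (1 - t) * ((-1) / (1 - t))) t :=
    ((hasDerivAt_id t).const_sub 1).mul (((hasDerivAt_id t).const_sub 1).log h2.ne')
  refine ((ha.add hb).div_const 2).congr_deriv ?_
  rw [Real.artanh_eq_half_log ⟨ht.1.le, ht.2.le⟩, Real.log_div h1.ne' h2.ne']
  field_simp
  ring

lemma continuous_hFun (p : ℕ) (b : ℝ) : Continuous (hFun p b) :=
  (continuous_const.mul (continuous_pow p)).sub continuous_entropyI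

lemma hFun_zero {p : ℕ} (hp : 3 ≤ p) (b : ℝ) : hFun p b 0 = 0 := by
  simp [hFun, entropyI_zero, show p ≠ 0 by omega]

lemma hFun_sub (p : ℕ) (b c t : ℝ) : hFun p b t = hFun p c t + (b - c) * t ^ p := by
  unfold hFun; ring

lemma hFun_le_abs (p : ℕ) {b : ℝ} (hb : 0 ≤ b) (t : ℝ) : hFun p b t ≤ hFun p b |t| := by
  unfold hFun
  rw [entropyI_abs]
  have h : t ^ p ≤ |t| ^ p := (le_abs_self _).trans (abs_pow t p).le
  gcongr

lemma hFun_eq_abs {p : ℕ} (b : ℝ) {t : ℝ} (ht : t ^ p = |t| ^ p) :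
    hFun p b t = hFun p b |t| := by
  unfold hFun
  rw [entropyI_abs, ht]

lemma hasDerivAt_hFun (p : ℕ) (b : ℝ) {t : ℝ} (ht : t ∈ Ioo (-1 : ℝ) 1) :
    HasDerivAt (hFun p b) (b * (p * t ^ (p - 1)) - Real.artanh t) t :=
  ((hasDerivAt_pow p t).const_mul b).sub (hasDerivAt_entropyI ht)

/-! ### The shape of `η_p` on `(0,1)`. -/

/-- The restriction of `η_p` to `(0,1)`, as a real-valued function. -/
def etaReal (p : ℕ) (t : ℝ) : ℝ := Real.artanh t / (p * t ^ (p - 1))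

lemma etaReal_denom_pos {p : ℕ} (hp : 3 ≤ p) {t : ℝ} (ht : 0 < t) :
    0 < (p : ℝ) * t ^ (p - 1) := by
  have : (0 : ℝ) < p := by exact_mod_cast (by omega : 0 < p)
  positivity

lemma etaReal_pos {p : ℕ} (hp : 3 ≤ p) {t : ℝ} (ht : t ∈ Ioo (0 : ℝ) 1) : 0 < etaReal p t :=
  div_pos (Real.artanh_pos ht) (etaReal_denom_pos hp ht.1)

/-- This factorization reduces the monotonicity of `H_b` to comparing `b` with `etaReal p`. -/
lemma deriv_hFun {p : ℕ} (hp : 3 ≤ p) (b : ℝ) {t : ℝ} (ht : t ∈ Ioo (0 : ℝ) 1) :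
    deriv (hFun p b) t = (b - etaReal p t) * (p * t ^ (p - 1)) := by
  rw [(hasDerivAt_hFun p b ⟨by linarith [ht.1], ht.2⟩).deriv, etaReal, sub_mul,
    div_mul_cancel₀ _ (etaReal_denom_pos hp ht.1).ne']

lemma strictMonoOn_hFun {p : ℕ} (hp : 3 ≤ p) {b r s : ℝ} (hr : 0 ≤ r) (hs : s ≤ 1)
    (h : ∀ t ∈ Ioo r s, etaReal p t < b) : StrictMonoOn (hFun p b) (Icc r s) := by
  refine strictMonoOn_of_deriv_pos (convex_Icc r s) (continuous_hFun p b).continuousOn ?_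
  intro t ht
  rw [interior_Icc] at ht
  rw [deriv_hFun hp b ⟨hr.trans_lt ht.1, ht.2.trans_le hs⟩]
  exact mul_pos (sub_pos.2 (h t ht)) (etaReal_denom_pos hp (hr.trans_lt ht.1))

lemma strictAntiOn_hFun {p : ℕ} (hp : 3 ≤ p) {b r s : ℝ} (hr : 0 ≤ r) (hs : s ≤ 1)
    (h : ∀ t ∈ Ioo r s, b < etaReal p t) : StrictAntiOn (hFun p b) (Icc r s) := by
  refine strictAntiOn_of_deriv_neg (convex_Icc r s) (continuous_hFun p b).continuousOn ?_
  intro t ht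
  rw [interior_Icc] at ht
  rw [deriv_hFun hp b ⟨hr.trans_lt ht.1, ht.2.trans_le hs⟩]
  exact mul_neg_of_neg_of_pos (sub_neg.2 (h t ht)) (etaReal_denom_pos hp (hr.trans_lt ht.1))

lemma continuousOn_etaReal {p : ℕ} (hp : 3 ≤ p) : ContinuousOn (etaReal p) (Ioo 0 1) := by
  intro t ht
  have h := (hasDerivAt_artanh (t := t) ⟨by linarith [ht.1], ht.2⟩).continuousAt
  exact (h.div (by fun_prop) (etaReal_denom_pos hp ht.1).ne').continuousWithinAt

/-- `η_p` is unbounded near `1`. -/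
lemma exists_lt_etaReal {p : ℕ} (hp : 3 ≤ p) (b : ℝ) {r : ℝ} (hr : r < 1) :
    ∃ t ∈ Ioo (0 : ℝ) 1, r < t ∧ b < etaReal p t := by
  have hp0 : (0 : ℝ) < p := by exact_mod_cast (by omega : 0 < p)
  have hmax : 0 ≤ max r 0 ∧ max r 0 < 1 := ⟨le_max_right _ _, max_lt hr one_pos⟩
  -- At `t = tanh y` the numerator of `etaReal` is `y` and the denominator is at most `p`. The first
  -- summand of `y` secures `r < t`, the second `b < etaReal p t`.
  set y : ℝ := Real.artanh (max r 0) + p * |b| + 1 with hy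
  have hy0 : 0 < y := by
    have := Real.artanh_nonneg hmax.1
    positivity
  have ht1 : Real.tanh y ∈ Ioo (-1 : ℝ) 1 := ⟨Real.neg_one_lt_tanh y, Real.tanh_lt_one y⟩
  have hrt : max r 0 < Real.tanh y := by
    rw [← Real.artanh_lt_artanh_iff ⟨by linarith, hmax.2⟩ ht1, Real.artanh_tanh]
    have : 0 ≤ p * |b| := by positivity
    linarith
  have ht0 : 0 < Real.tanh y := hmax.1.trans_lt hrt
  refine ⟨Real.tanh y, ⟨ht0, ht1.2⟩, (le_max_left _ _).trans_lt hrt, ?_⟩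
  rw [etaReal, Real.artanh_tanh, lt_div_iff₀ (etaReal_denom_pos hp ht0)]
  have h1 : Real.tanh y ^ (p - 1) ≤ 1 := pow_le_one₀ ht0.le ht1.2.le
  have h2 : 0 ≤ Real.tanh y ^ (p - 1) := pow_nonneg ht0.le _
  have h3 : b * (p * Real.tanh y ^ (p - 1)) ≤ p * |b| := by
    calc b * (p * Real.tanh y ^ (p - 1)) ≤ |b| * (p * 1) := by
          gcongr
          exact le_abs_self b
      _ = p * |b| := by ring
  have := Real.artanh_nonneg hmax.1
  linarith

/-- The numerator of the derivative of `η_p`, which determines its sign. -/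
def etaSlope (p : ℕ) (t : ℝ) : ℝ := t / (1 - t ^ 2) - (p - 1) * Real.artanh t

lemma hasDerivAt_etaSlope (p : ℕ) {t : ℝ} (ht : t ∈ Ioo (-1 : ℝ) 1) :
    HasDerivAt (etaSlope p) ((2 - p + p * t ^ 2) / (1 - t ^ 2) ^ 2) t := by
  have h3 : 1 - t ^ 2 ≠ 0 := by nlinarith [ht.1, ht.2]
  have hq : HasDerivAt (fun x : ℝ => 1 - x ^ 2) (-(2 * t)) t := by
    simpa using (hasDerivAt_pow 2 t).const_sub 1
  refine (((hasDerivAt_id t).div hq h3).sub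
    ((hasDerivAt_artanh ht).const_mul ((p : ℝ) - 1))).congr_deriv ?_
  simp only [id]
  field_simp
  ring

lemma hasDerivAt_etaReal {p : ℕ} (hp : 3 ≤ p) {t : ℝ} (ht : t ∈ Ioo (0 : ℝ) 1) :
    HasDerivAt (etaReal p) (etaSlope p t / (p * t ^ p)) t := by
  have h3 : 1 - t ^ 2 ≠ 0 := by nlinarith [ht.1, ht.2]
  have hp0 : (p : ℝ) ≠ 0 := by exact_mod_cast (by omega : p ≠ 0)
  have ht0 : t ≠ 0 := ht.1.ne'
  refine ((hasDerivAt_artanh ⟨by linarith [ht.1], ht.2⟩).div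
    ((hasDerivAt_pow (p - 1) t).const_mul (p : ℝ)) (etaReal_denom_pos hp ht.1).ne').congr_deriv ?_
  obtain ⟨q, rfl⟩ : ∃ q, p = q + 2 := ⟨p - 2, by omega⟩
  rw [etaSlope]
  simp only [show q + 2 - 1 = q + 1 by omega, show q + 1 - 1 = q by omega]
  push_cast at hp0 ⊢
  field_simp
  ring

/-- On `(0,1)`, the function `η_p` is strictly decreasing up to `c` and then strictly
increasing. -/
structure IsTurningPoint (p : ℕ) (c : ℝ) : Prop where
  mem : c ∈ Ioo (0 : ℝ) 1
  strictAntiOn : StrictAntiOn (etaReal p) (Ioc 0 c)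
  strictMonoOn : StrictMonoOn (etaReal p) (Ico c 1)

/-- `etaSlope` is `0` at `0`, decreases up to `e = √((p - 2) / p)`, where the numerator of its
derivative changes sign, and increases afterwards. So it changes sign at most once on `(0,1)`, from
negative to positive. -/
lemma exists_isTurningPoint {p : ℕ} (hp : 3 ≤ p) : ∃ c, IsTurningPoint p c := by
  have hp3 : (3 : ℝ) ≤ p := by exact_mod_cast hp
  have hp0 : (0 : ℝ) < p := by linarith
  obtain ⟨e, he0, he⟩ : ∃ e : ℝ, 0 < e ∧ e ^ 2 = (p - 2) / p :=
    ⟨√((p - 2) / p), Real.sqrt_pos.2 (div_pos (by linarith) hp0),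
      Real.sq_sqrt (div_nonneg (by linarith) hp0.le)⟩
  have hpe : p * e ^ 2 = p - 2 := by rw [he]; field_simp
  have he1 : e < 1 := by
    by_contra! h
    have h1 : 1 ≤ e ^ 2 := one_le_pow₀ h
    nlinarith
  have hmem : ∀ t ∈ Ico (0 : ℝ) 1, t ∈ Ioo (-1 : ℝ) 1 := fun t ht => ⟨by linarith [ht.1], ht.2⟩
  have hcont : ContinuousOn (etaSlope p) (Ico 0 1) := fun t ht =>
    (hasDerivAt_etaSlope p (hmem t ht)).continuousAt.continuousWithinAt
  have hanti : StrictAntiOn (etaSlope p) (Icc 0 e) := by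
    refine strictAntiOn_of_deriv_neg (convex_Icc 0 e)
      (hcont.mono fun t ht => ⟨ht.1, ht.2.trans_lt he1⟩) ?_
    intro t ht
    rw [interior_Icc] at ht
    have ht' := hmem t ⟨ht.1.le, ht.2.trans he1⟩
    rw [(hasDerivAt_etaSlope p ht').deriv]
    have h3 : 0 < 1 - t ^ 2 := by nlinarith [ht'.1, ht'.2]
    have h4 : t ^ 2 < e ^ 2 := by nlinarith [ht.1, ht.2]
    exact div_neg_of_neg_of_pos (by nlinarith) (by positivity)
  have hmono : StrictMonoOn (etaSlope p) (Ico e 1) := by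
    refine strictMonoOn_of_deriv_pos (convex_Ico e 1)
      (hcont.mono fun t ht => ⟨he0.le.trans ht.1, ht.2⟩) ?_
    intro t ht
    rw [interior_Ico] at ht
    have ht' := hmem t ⟨he0.le.trans ht.1.le, ht.2⟩
    rw [(hasDerivAt_etaSlope p ht').deriv]
    have h3 : 0 < 1 - t ^ 2 := by nlinarith [ht'.1, ht'.2]
    have h4 : e ^ 2 < t ^ 2 := by nlinarith [ht.1, ht.2]
    exact div_pos (by nlinarith) (by positivity)
  have h0 : etaSlope p 0 = 0 := by simp [etaSlope]
  have hneg : ∀ t, 0 < t → t ≤ e → etaSlope p t < 0 := fun t h1 h2 =>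
    h0 ▸ hanti ⟨le_rfl, he0.le⟩ ⟨h1.le, h2⟩ h1
  -- Otherwise `etaReal p` would be antitone on `(0,1)`, although it is unbounded near `1`.
  obtain ⟨r, hr, hr0⟩ : ∃ r ∈ Ioo (0 : ℝ) 1, 0 < etaSlope p r := by
    by_contra! h
    have hA : AntitoneOn (etaReal p) (Ioo 0 1) := by
      refine antitoneOn_of_deriv_nonpos (convex_Ioo 0 1) (continuousOn_etaReal hp)
        (fun t ht => ?_) (fun t ht => ?_)
      · rw [interior_Ioo] at ht
        exact (hasDerivAt_etaReal hp ht).differentiableAt.differentiableWithinAt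
      · rw [interior_Ioo] at ht
        rw [(hasDerivAt_etaReal hp ht).deriv]
        have := ht.1
        exact div_nonpos_of_nonpos_of_nonneg (h t ht) (by positivity)
    obtain ⟨t, ht, h1, h2⟩ := exists_lt_etaReal hp (etaReal p 2⁻¹) (r := 2⁻¹) (by norm_num)
    exact absurd (hA (by constructor <;> norm_num) ht h1.le) (not_le.2 h2)
  have her : e < r := by
    by_contra! h
    exact absurd (hneg r hr.1 h) (not_lt.2 hr0.le)
  obtain ⟨c, hc, hc0⟩ := intermediate_value_Ioo her.le
    (hcont.mono fun t ht => ⟨he0.le.trans ht.1, ht.2.trans_lt hr.2⟩) ⟨hneg e he0 le_rfl, hr0⟩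
  have hc1 : c < 1 := hc.2.trans hr.2
  have hcpos : 0 < c := he0.trans hc.1
  refine ⟨c, ⟨⟨hcpos, hc1⟩, ?_, ?_⟩⟩
  · refine strictAntiOn_of_deriv_neg (convex_Ioc 0 c)
      ((continuousOn_etaReal hp).mono fun t ht => ⟨ht.1, ht.2.trans_lt hc1⟩) ?_
    intro t ht
    rw [interior_Ioc] at ht
    rw [(hasDerivAt_etaReal hp ⟨ht.1, ht.2.trans hc1⟩).deriv]
    have := ht.1
    refine div_neg_of_neg_of_pos ?_ (by positivity)
    rcases le_total t e with h | h
    · exact hneg t ht.1 h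
    · exact hc0 ▸ hmono ⟨h, ht.2.trans hc1⟩ ⟨hc.1.le, hc1⟩ ht.2
  · refine strictMonoOn_of_deriv_pos (convex_Ico c 1)
      ((continuousOn_etaReal hp).mono fun t ht => ⟨hcpos.trans_le ht.1, ht.2⟩) ?_
    intro t ht
    rw [interior_Ico] at ht
    have htp := hcpos.trans ht.1
    rw [(hasDerivAt_etaReal hp ⟨htp, ht.2⟩).deriv]
    refine div_pos ?_ (by positivity)
    exact hc0 ▸ hmono ⟨hc.1.le, hc1⟩ ⟨(hc.1.trans ht.1).le, ht.2⟩ ht.1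

/-- `η_p` is unbounded near `0`. -/
lemma exists_forall_lt_etaReal {p : ℕ} (hp : 3 ≤ p) (b : ℝ) :
    ∃ r ∈ Ioo (0 : ℝ) 1, ∀ t ∈ Ioo 0 r, b < etaReal p t := by
  have hp3 : (3 : ℝ) ≤ p := by exact_mod_cast hp
  have hB : 0 < 2 * p * (|b| + 1) := by positivity
  -- Below this radius `p |b| t ^ 2 < t / 2 ≤ artanh t`, and `t ^ (p - 1) ≤ t ^ 2` because `p ≥ 3`.
  refine ⟨(2 * p * (|b| + 1))⁻¹, ⟨inv_pos.2 hB, inv_lt_one_of_one_lt₀ ?_⟩, fun t ht => ?_⟩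
  · nlinarith [abs_nonneg b]
  have ht0 := ht.1
  have htB : t * (2 * p * (|b| + 1)) < 1 := by
    rw [← lt_div_iff₀ hB, one_div]
    exact ht.2
  have ht1 : t < 1 := by nlinarith [abs_nonneg b]
  have hart : t / 2 ≤ Real.artanh t := by
    rw [Real.artanh_eq_half_log ⟨by linarith, ht1.le⟩, Real.log_div (by linarith) (by linarith)]
    have h1 : 0 ≤ Real.log (1 + t) := Real.log_nonneg (by linarith)
    have h2 := Real.log_le_sub_one_of_pos (show 0 < 1 - t by linarith)
    linarith
  rw [etaReal, lt_div_iff₀ (etaReal_denom_pos hp ht0)]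
  refine lt_of_lt_of_le ?_ hart
  obtain ⟨q, rfl⟩ : ∃ q, p = q + 3 := ⟨p - 3, by omega⟩
  rw [show q + 3 - 1 = q + 2 by omega]
  have hq : t ^ (q + 2) ≤ t ^ 2 := pow_le_pow_of_le_one ht0.le ht1.le (by omega)
  set P : ℝ := ((q + 3 : ℕ) : ℝ) with hP
  have h1 : b * (P * t ^ (q + 2)) ≤ |b| * (P * t ^ 2) := by
    gcongr
    exact le_abs_self b
  have h2 : t * (t * (2 * P * (|b| + 1))) < t * 1 := by gcongr
  nlinarith [mul_pos ht0 ht0]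

/-! ### The threshold `β*(p)`. -/

lemma entropyI_nonneg {p : ℕ} (hp : 3 ≤ p) {t : ℝ} (ht : t ∈ Icc (-1 : ℝ) 1) :
    0 ≤ entropyI t := by
  rw [← entropyI_abs]
  have h1 : |t| ≤ 1 := abs_le.2 ht
  -- For `b = 0` the function `H_b` is `-I`, and `0 < etaReal p` makes it decrease from `H_0 0 = 0`.
  have h := (strictAntiOn_hFun hp (b := 0) le_rfl le_rfl fun t ht => etaReal_pos hp ht).antitoneOn
    (left_mem_Icc.2 zero_le_one) ⟨abs_nonneg t, h1⟩ (abs_nonneg t)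
  rw [hFun_zero hp] at h
  simpa [hFun] using h

lemma entropyI_pos {p : ℕ} (hp : 3 ≤ p) {t : ℝ} (ht : t ∈ Ioc (0 : ℝ) 1) : 0 < entropyI t := by
  have h := (strictAntiOn_hFun hp (b := 0) le_rfl le_rfl fun t ht => etaReal_pos hp ht)
    (left_mem_Icc.2 zero_le_one) ⟨ht.1.le, ht.2⟩ ht.1
  rw [hFun_zero hp] at h
  simpa [hFun] using h

lemma bddAbove_hFun (p : ℕ) (b : ℝ) : BddAbove (hFun p b '' Icc (-1) 1) :=
  isCompact_Icc.bddAbove_image (continuous_hFun p b).continuousOn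

lemma bddAbove_threshold (p : ℕ) :
    BddAbove {b : ℝ | 0 ≤ b ∧ sSup (hFun p b '' Icc (-1) 1) = 0} := by
  refine ⟨entropyI 1, fun b hb => ?_⟩
  have h := le_csSup (bddAbove_hFun p b) (mem_image_of_mem _ (right_mem_Icc.2 (by norm_num)))
  rw [hb.2] at h
  simpa [hFun] using h

lemma sSup_hFun_nonneg {p : ℕ} (hp : 3 ≤ p) (b : ℝ) : 0 ≤ sSup (hFun p b '' Icc (-1) 1) := by
  rw [← hFun_zero hp b]
  exact le_csSup (bddAbove_hFun p b) (mem_image_of_mem _ (by simp))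

lemma zero_mem_threshold {p : ℕ} (hp : 3 ≤ p) :
    (0 : ℝ) ∈ {b : ℝ | 0 ≤ b ∧ sSup (hFun p b '' Icc (-1) 1) = 0} := by
  refine ⟨le_rfl, le_antisymm (csSup_le ((nonempty_Icc.2 (by norm_num)).image _) ?_)
    (sSup_hFun_nonneg hp 0)⟩
  rintro _ ⟨t, ht, rfl⟩
  simpa [hFun] using entropyI_nonneg hp ht

lemma betaStar_nonneg {p : ℕ} (hp : 3 ≤ p) : 0 ≤ betaStar p :=
  le_csSup (bddAbove_threshold p) (zero_mem_threshold hp)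

lemma exists_hFun_pos {p : ℕ} (hp : 3 ≤ p) {b : ℝ} (hb : betaStar p < b) :
    ∃ t ∈ Ioc (0 : ℝ) 1, 0 < hFun p b t := by
  have hb0 : 0 ≤ b := (betaStar_nonneg hp).trans hb.le
  have hS : sSup (hFun p b '' Icc (-1) 1) ≠ 0 := fun h =>
    absurd (le_csSup (bddAbove_threshold p) ⟨hb0, h⟩) (not_le.2 hb)
  obtain ⟨_, ⟨t, ht, rfl⟩, h⟩ := exists_lt_of_lt_csSup ((nonempty_Icc.2 (by norm_num)).image _)
    ((sSup_hFun_nonneg hp b).lt_of_ne' hS)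
  refine ⟨|t|, ⟨abs_pos.2 ?_, abs_le.2 ht⟩, h.trans_le (hFun_le_abs p hb0 t)⟩
  rintro rfl
  rw [hFun_zero hp] at h
  exact lt_irrefl _ h

/-- A positive value at `t` would persist for parameters slightly below the threshold, since `H`
changes by at most the change of `b`. No such parameter could then belong to the set whose supremum
is `betaStar p`. -/
lemma hFun_betaStar_nonpos {p : ℕ} (hp : 3 ≤ p) {t : ℝ} (ht : t ∈ Icc (0 : ℝ) 1) :
    hFun p (betaStar p) t ≤ 0 := by
  by_contra! h
  have h1 : t ^ p ≤ 1 := pow_le_one₀ ht.1 ht.2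
  have h0 : 0 ≤ t ^ p := pow_nonneg ht.1 p
  have hub : betaStar p ≤ betaStar p - hFun p (betaStar p) t / 2 := by
    refine csSup_le ⟨0, zero_mem_threshold hp⟩ fun b hb => ?_
    by_contra! hlt
    have h2 := le_csSup (bddAbove_hFun p b) (mem_image_of_mem (hFun p b)
      (show t ∈ Icc (-1 : ℝ) 1 from ⟨by linarith [ht.1], ht.2⟩))
    rw [hb.2, hFun_sub p b (betaStar p)] at h2
    nlinarith
  linarith

/-! ### The maximizer of `H`. -/

/-- `m` is the unique maximizer of `H_{b,p}` on `[0,1]`, to the right of the turning point `c` of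
`η_p`, and the maximum is positive. -/
structure IsMagnetization (p : ℕ) (c b m : ℝ) : Prop where
  mem : m ∈ Ioo c 1
  etaReal_eq : etaReal p m = b
  hFun_pos : 0 < hFun p b m
  hFun_lt : ∀ t ∈ Icc (0 : ℝ) 1, t ≠ m → hFun p b t < hFun p b m

/-- To the left of `t` the decreasing branch of `η_p` stays above `b`, so `H_b` decreases from its
value `0` at the origin. -/
lemma hFun_neg_of_lt_etaReal {p : ℕ} (hp : 3 ≤ p) {c : ℝ} (hc : IsTurningPoint p c) {b t : ℝ}
    (ht : t ∈ Ioc 0 c) (h : b ≤ etaReal p t) : hFun p b t < 0 := by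
  have hanti := strictAntiOn_hFun hp (b := b) le_rfl (ht.2.trans hc.mem.2.le) fun u hu =>
    h.trans_lt (hc.strictAntiOn ⟨hu.1, hu.2.le.trans ht.2⟩ ht hu.2)
  rw [← hFun_zero hp b]
  exact hanti (left_mem_Icc.2 ht.1.le) (right_mem_Icc.2 ht.1.le) ht.1

lemma exists_isMagnetization {p : ℕ} (hp : 3 ≤ p) {c : ℝ} (hc : IsTurningPoint p c) {b : ℝ}
    (hb : betaStar p < b) : ∃ m, IsMagnetization p c b m := by
  obtain ⟨c0, c1⟩ := hc.mem
  obtain ⟨t, ht, hHt⟩ := exists_hFun_pos hp hb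
  -- If `b` were at most the minimum of `η_p`, then `H_b` would decrease on all of `[0,1]` and be
  -- negative on `(0,1]`, against `hHt`.
  have hcb : etaReal p c < b := by
    by_contra! h
    have hanti := strictAntiOn_hFun hp (b := b) (r := 0) (s := 1) le_rfl le_rfl
    by_cases htc : t ≤ c
    · refine lt_asymm hHt (hFun_neg_of_lt_etaReal hp hc ⟨ht.1, htc⟩ (h.trans ?_))
      exact hc.strictAntiOn.antitoneOn ⟨ht.1, htc⟩ ⟨c0, le_rfl⟩ htc
    · push Not at htc
      have h1 := hFun_neg_of_lt_etaReal hp hc ⟨c0, le_rfl⟩ h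
      have h2 := strictAntiOn_hFun hp (b := b) c0.le ht.2 fun u hu =>
        h.trans_lt (hc.strictMonoOn ⟨le_rfl, c1⟩ ⟨hu.1.le, hu.2.trans_le ht.2⟩ hu.1)
      have h3 := h2 (left_mem_Icc.2 htc.le) (right_mem_Icc.2 htc.le) htc
      linarith
  obtain ⟨r, hr, hcr, hbr⟩ := exists_lt_etaReal hp b c1
  obtain ⟨m, hm, hmb⟩ := intermediate_value_Ioo hcr.le
    ((continuousOn_etaReal hp).mono fun t ht => ⟨c0.trans_le ht.1, ht.2.trans_lt hr.2⟩) ⟨hcb, hbr⟩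
  have hm1 : m < 1 := hm.2.trans hr.2
  have hm0 : 0 < m := c0.trans hm.1
  have hanti : StrictAntiOn (hFun p b) (Icc m 1) :=
    strictAntiOn_hFun hp hm0.le le_rfl fun u hu => by
      rw [← hmb]
      exact hc.strictMonoOn ⟨hm.1.le, hm1⟩ ⟨(hm.1.trans hu.1).le, hu.2⟩ hu.1
  -- Either `u` lies on the initial stretch where `H_b` decreases from `0`, or `η_p < b` on all of
  -- `(u, m)` and `H_b` increases up to `m`.
  have hleft : ∀ u ∈ Ioo 0 m, hFun p b u < 0 ∨ hFun p b u < hFun p b m := by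
    intro u hu
    by_cases h : u ≤ c ∧ b ≤ etaReal p u
    · exact Or.inl (hFun_neg_of_lt_etaReal hp hc ⟨hu.1, h.1⟩ h.2)
    refine Or.inr (strictMonoOn_hFun hp hu.1.le hm1.le (fun v hv => ?_)
      (left_mem_Icc.2 hu.2.le) (right_mem_Icc.2 hu.2.le) hu.2)
    rcases le_total v c with hvc | hvc
    · have huc := hv.1.le.trans hvc
      have hub : etaReal p u < b := by
        by_contra! h'
        exact h ⟨huc, h'⟩
      exact (hc.strictAntiOn ⟨hu.1, huc⟩ ⟨hu.1.trans hv.1, hvc⟩ hv.1).trans hub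
    · rw [← hmb]
      exact hc.strictMonoOn ⟨hvc, hv.2.trans hm1⟩ ⟨hm.1.le, hm1⟩ hv.2
  have hpos : 0 < hFun p b m := by
    rcases lt_or_ge t m with h | h
    · rcases hleft t ⟨ht.1, h⟩ with h' | h' <;> linarith
    · exact hHt.trans_le (hanti.antitoneOn (left_mem_Icc.2 hm1.le) ⟨h, ht.2⟩ h)
  refine ⟨m, ⟨hm.1, hm1⟩, hmb, hpos, fun u hu hne => ?_⟩
  rcases hne.lt_or_gt with h | h
  · rcases hu.1.eq_or_lt with rfl | h0
    · rwa [hFun_zero hp]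
    · rcases hleft u ⟨h0, h⟩ with h' | h' <;> linarith
  · exact hanti (left_mem_Icc.2 hm1.le) ⟨h.le, hu.2⟩ h

namespace IsMagnetization

variable {p : ℕ} {c b m : ℝ}

lemma pos (hc : IsTurningPoint p c) (hm : IsMagnetization p c b m) : 0 < m :=
  hc.mem.1.trans hm.mem.1

lemma hFun_le (hm : IsMagnetization p c b m) {t : ℝ} (ht : t ∈ Icc (0 : ℝ) 1) :
    hFun p b t ≤ hFun p b m := by
  rcases eq_or_ne t m with rfl | h
  · exact le_rfl
  · exact (hm.hFun_lt t ht h).le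

lemma hFun_le_of_abs_le (hb : 0 ≤ b) (hm : IsMagnetization p c b m) {t : ℝ} (ht : |t| ≤ 1) :
    hFun p b t ≤ hFun p b m :=
  (hFun_le_abs p hb t).trans (hm.hFun_le ⟨abs_nonneg t, ht⟩)

lemma posMaximizers_eq (hc : IsTurningPoint p c) (hb : 0 ≤ b) (hm : IsMagnetization p c b m) :
    posMaximizers p b = {m} := by
  have hm0 := hm.pos hc
  have hm1 := hm.mem.2
  ext t
  refine ⟨fun ht => ?_, ?_⟩
  · by_contra hne
    have h := ht.2 (show m ∈ Icc (-1 : ℝ) 1 from ⟨by linarith, hm1.le⟩)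
    exact absurd h (not_le.2 (hm.hFun_lt t ⟨ht.1.1.le, ht.1.2⟩ hne))
  · rintro rfl
    exact ⟨⟨hm0, hm1.le⟩, fun t ht => hm.hFun_le_of_abs_le hb (abs_le.2 ht)⟩

lemma lt_of_lt (hc : IsTurningPoint p c) (hm : IsMagnetization p c b m) {b' m' : ℝ}
    (hm' : IsMagnetization p c b' m') (h : b < b') : m < m' := by
  rw [← hm.etaReal_eq, ← hm'.etaReal_eq] at h
  exact (hc.strictMonoOn.lt_iff_lt ⟨hm.mem.1.le, hm.mem.2⟩ ⟨hm'.mem.1.le, hm'.mem.2⟩).1 h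

lemma strictAntiOn (hp : 3 ≤ p) (hc : IsTurningPoint p c) (hm : IsMagnetization p c b m) :
    StrictAntiOn (hFun p b) (Icc m 1) :=
  strictAntiOn_hFun hp (hm.pos hc).le le_rfl fun u hu => by
    rw [← hm.etaReal_eq]
    exact hc.strictMonoOn ⟨hm.mem.1.le, hm.mem.2⟩ ⟨(hm.mem.1.trans hu.1).le, hu.2⟩ hu.1

/-- If `H_{β*}` vanished at `m`, then `m` would be an interior local maximum and hence critical,
giving `etaReal p m = betaStar p`. But `etaReal p m = b` is larger. -/
lemma hFun_betaStar_neg (hp : 3 ≤ p) (hc : IsTurningPoint p c) (hb : betaStar p < b)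
    (hm : IsMagnetization p c b m) : hFun p (betaStar p) m < 0 := by
  have hm0 := hm.pos hc
  have hm1 := hm.mem.2
  by_contra! h
  have hmax : IsLocalMax (hFun p (betaStar p)) m := by
    filter_upwards [Ioo_mem_nhds hm0 hm1] with t ht
    exact (hFun_betaStar_nonpos hp ⟨ht.1.le, ht.2.le⟩).trans h
  have hd := hmax.deriv_eq_zero
  rw [deriv_hFun hp _ ⟨hm0, hm1⟩, hm.etaReal_eq, mul_eq_zero] at hd
  rcases hd with hd | hd
  · linarith
  · exact (etaReal_denom_pos hp hm0).ne' hd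

end IsMagnetization

/-! ### Counting configurations -/

/-- The Poisson weights `k ^ j / j!` are largest at `j = k`. -/
lemma factorial_mul_pow_le (k j : ℕ) : k.factorial * k ^ j ≤ j.factorial * k ^ k := by
  rcases le_total j k with h | h
  · obtain ⟨d, rfl⟩ := Nat.exists_eq_add_of_le h
    have h1 := Nat.factorial_mul_pow_sub_le_factorial h
    have h2 : (j + d).factorial ≤ j.factorial * (j + d) ^ d := by
      rw [← Nat.factorial_mul_ascFactorial]
      exact Nat.mul_le_mul_left _ (Nat.ascFactorial_le_pow_add j d)
    calc (j + d).factorial * (j + d) ^ j ≤ j.factorial * (j + d) ^ d * (j + d) ^ j := by gcongr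
      _ = _ := by ring
  · obtain ⟨d, rfl⟩ := Nat.exists_eq_add_of_le h
    have h2 : k.factorial * k ^ d ≤ (k + d).factorial := by
      refine le_trans ?_ (Nat.factorial_mul_pow_le_factorial)
      gcongr
      omega
    calc k.factorial * k ^ (k + d) = k.factorial * k ^ d * k ^ k := by ring
      _ ≤ _ := by gcongr

/-- A binomial law with success probability `k / n` has mode `k`; this is the product of two Poisson
comparisons. -/
lemma choose_mul_pow_le_mode {n k j : ℕ} (hk : k ≤ n) (hj : j ≤ n) :
    n.choose j * (k ^ j * (n - k) ^ (n - j)) ≤ n.choose k * (k ^ k * (n - k) ^ (n - k)) := by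
  have hpos : 0 < j.factorial * (n - j).factorial * (k.factorial * (n - k).factorial) := by
    positivity
  refine Nat.le_of_mul_le_mul_left ?_ hpos
  have h1 := Nat.choose_mul_factorial_mul_factorial hk
  have h2 := Nat.choose_mul_factorial_mul_factorial hj
  have h3 := Nat.mul_le_mul (factorial_mul_pow_le k j) (factorial_mul_pow_le (n - k) (n - j))
  calc j.factorial * (n - j).factorial * (k.factorial * (n - k).factorial) *
        (n.choose j * (k ^ j * (n - k) ^ (n - j)))
      = (n.choose j * j.factorial * (n - j).factorial) *
        (k.factorial * k ^ j * ((n - k).factorial * (n - k) ^ (n - j))) := by ring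
    _ ≤ (n.choose k * k.factorial * (n - k).factorial) *
        (j.factorial * k ^ k * ((n - j).factorial * (n - k) ^ (n - k))) := by
        rw [h1, h2]
        gcongr
    _ = _ := by ring

lemma choose_mul_pow_le {n k : ℕ} (hk : k ≤ n) :
    n.choose k * (k ^ k * (n - k) ^ (n - k)) ≤ n ^ n := by
  have h := add_pow k (n - k) n
  rw [Nat.add_sub_cancel' hk] at h
  rw [h]
  have := Finset.single_le_sum (f := fun m => k ^ m * (n - k) ^ (n - m) * n.choose m)
    (fun _ _ => Nat.zero_le _) (Finset.mem_range.2 (Nat.lt_succ_of_le hk))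
  simpa [mul_comm] using this

/-- The expansion of `(k + (n - k)) ^ n` has `n + 1` terms, and the largest one is at least their
average. -/
lemma pow_le_choose_mul {n k : ℕ} (hk : k ≤ n) :
    n ^ n ≤ (n + 1) * (n.choose k * (k ^ k * (n - k) ^ (n - k))) := by
  have h := add_pow k (n - k) n
  rw [Nat.add_sub_cancel' hk] at h
  rw [h]
  refine (Finset.sum_le_card_nsmul _ _ (n.choose k * (k ^ k * (n - k) ^ (n - k)))
    fun j hj => ?_).trans (by simp)
  rw [Nat.cast_id, mul_comm _ (n.choose j)]
  exact choose_mul_pow_le_mode hk (Nat.lt_succ_iff.1 (Finset.mem_range.1 hj))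

/-- The possible values of the average magnetization. -/
def gridPoint (n k : ℕ) : ℝ := (2 * k - n) / n

lemma gridPoint_mem {n k : ℕ} (hk : k ≤ n) : gridPoint n k ∈ Icc (-1 : ℝ) 1 := by
  have hk' : (k : ℝ) ≤ n := by exact_mod_cast hk
  have hk0 : (0 : ℝ) ≤ k := k.cast_nonneg
  rcases n.eq_zero_or_pos with rfl | hn
  · simp [gridPoint]
  have hn' : (0 : ℝ) < n := by exact_mod_cast hn
  rw [gridPoint, mem_Icc, le_div_iff₀ hn', div_le_iff₀ hn']
  constructor <;> linarith

lemma pow_mul_exp_entropyI {n k : ℕ} (hn : 0 < n) (hk : k ≤ n) :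
    (n : ℝ) ^ n * Real.exp (n * entropyI (gridPoint n k)) =
      2 ^ n * ((k : ℝ) ^ k * ((n - k : ℕ) : ℝ) ^ (n - k)) := by
  have hn' : (0 : ℝ) < n := by exact_mod_cast hn
  -- At `j = 0` both sides are `1`, by the conventions `0 * log 0 = 0` and `0 ^ 0 = 1`.
  have key : ∀ j : ℕ, Real.exp (j * Real.log (2 * j / n)) = 2 ^ j * (j : ℝ) ^ j / n ^ j := by
    intro j
    rcases j.eq_zero_or_pos with rfl | hj
    · simp
    have hj' : (0 : ℝ) < j := by exact_mod_cast hj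
    rw [mul_comm, Real.exp_mul, Real.exp_log (by positivity), Real.rpow_natCast, div_pow, mul_pow]
  have h1 : 1 + gridPoint n k = 2 * k / n := by
    rw [gridPoint]; field_simp; ring
  have h2 : 1 - gridPoint n k = 2 * (n - k : ℕ) / n := by
    rw [gridPoint, Nat.cast_sub hk]; field_simp; ring
  have h3 : n * entropyI (gridPoint n k) =
      k * Real.log (2 * k / n) + (n - k : ℕ) * Real.log (2 * (n - k : ℕ) / n) := by
    rw [entropyI, h1, h2]; field_simp
  obtain ⟨d, rfl⟩ := Nat.exists_eq_add_of_le hk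
  rw [h3, Real.exp_add, key, key, Nat.add_sub_cancel_left]
  field_simp
  ring

lemma choose_le_exp {n k : ℕ} (hn : 0 < n) (hk : k ≤ n) :
    (n.choose k : ℝ) ≤ 2 ^ n * Real.exp (-(n * entropyI (gridPoint n k))) := by
  have hn' : (0 : ℝ) < n := by exact_mod_cast hn
  have h : (n.choose k : ℝ) * ((k : ℝ) ^ k * ((n - k : ℕ) : ℝ) ^ (n - k)) ≤ (n : ℝ) ^ n := by
    exact_mod_cast choose_mul_pow_le hk
  rw [Real.exp_neg, ← div_eq_mul_inv, le_div_iff₀ (Real.exp_pos _)]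
  have hN : (0 : ℝ) < (n : ℝ) ^ n := by positivity
  refine le_of_mul_le_mul_left ?_ hN
  calc (n : ℝ) ^ n * (n.choose k * Real.exp (n * entropyI (gridPoint n k)))
      = n.choose k * ((n : ℝ) ^ n * Real.exp (n * entropyI (gridPoint n k))) := by ring
    _ = 2 ^ n * (n.choose k * ((k : ℝ) ^ k * ((n - k : ℕ) : ℝ) ^ (n - k))) := by
        rw [pow_mul_exp_entropyI hn hk]; ring
    _ ≤ 2 ^ n * (n : ℝ) ^ n := by gcongr
    _ = _ := by ring

lemma exp_le_choose {n k : ℕ} (hn : 0 < n) (hk : k ≤ n) :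
    2 ^ n * Real.exp (-(n * entropyI (gridPoint n k))) ≤ (n + 1) * (n.choose k : ℝ) := by
  have hn' : (0 : ℝ) < n := by exact_mod_cast hn
  have h : (n : ℝ) ^ n ≤
      (n + 1) * ((n.choose k : ℝ) * ((k : ℝ) ^ k * ((n - k : ℕ) : ℝ) ^ (n - k))) := by
    exact_mod_cast pow_le_choose_mul hk
  rw [Real.exp_neg, ← div_eq_mul_inv, div_le_iff₀ (Real.exp_pos _)]
  have hN : (0 : ℝ) < (n : ℝ) ^ n := by positivity
  refine le_of_mul_le_mul_left ?_ hN
  calc (n : ℝ) ^ n * 2 ^ n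
      ≤ ((n + 1) * ((n.choose k : ℝ) * ((k : ℝ) ^ k * ((n - k : ℕ) : ℝ) ^ (n - k)))) * 2 ^ n := by
        gcongr
    _ = (n + 1) * n.choose k * (2 ^ n * ((k : ℝ) ^ k * ((n - k : ℕ) : ℝ) ^ (n - k))) := by ring
    _ = _ := by rw [← pow_mul_exp_entropyI hn hk]; ring

/-- Configurations correspond to the set of their positive spins. -/
def configEquiv (n : ℕ) : Config n ≃ Finset (Fin n) where
  toFun x := Finset.univ.filter fun i => x i = 1
  invFun s i := if i ∈ s then 1 else -1
  left_inv x := by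
    funext i
    rcases Int.units_eq_one_or (x i) with h | h <;> simp [h]
  right_inv s := by
    ext i
    by_cases h : i ∈ s <;> simp [h]

lemma avgMag_eq_gridPoint {n : ℕ} (x : Config n) :
    avgMag n x = gridPoint n (configEquiv n x).card := by
  have h : ∀ i, (((x i : ℤˣ) : ℤ) : ℝ) = 2 * (if x i = 1 then 1 else 0) - 1 := by
    intro i
    rcases Int.units_eq_one_or (x i) with h | h <;> norm_num [h]
  rw [avgMag, gridPoint]
  simp_rw [h]
  rw [Finset.sum_sub_distrib, ← Finset.mul_sum, Finset.sum_boole]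
  simp [configEquiv]

lemma avgMag_mem {n : ℕ} (x : Config n) : avgMag n x ∈ Icc (-1 : ℝ) 1 := by
  rw [avgMag_eq_gridPoint]
  exact gridPoint_mem (by simpa using Finset.card_le_univ (configEquiv n x))

lemma abs_avgMag_le_one {n : ℕ} (x : Config n) : |avgMag n x| ≤ 1 := abs_le.2 (avgMag_mem x)

/-- Everything in the model depends on the magnetization only, so sums over `2 ^ n` configurations
collapse to `n + 1` terms. -/
lemma sum_config (n : ℕ) (f : ℝ → ℝ) :
    ∑ x : Config n, f (avgMag n x) =
      ∑ k ∈ Finset.range (n + 1), (n.choose k : ℝ) * f (gridPoint n k) := by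
  simp_rw [avgMag_eq_gridPoint]
  rw [(configEquiv n).sum_comp fun s => f (gridPoint n s.card), ← Finset.powerset_univ,
    Finset.sum_powerset_apply_card fun k => f (gridPoint n k)]
  simp

lemma suffStat_eq (p : ℕ) {n : ℕ} (hn : 0 < n) (x : Config n) :
    suffStat p n x = n * avgMag n x ^ p := by
  have hn' : (n : ℝ) ≠ 0 := by exact_mod_cast hn.ne'
  rw [suffStat, avgMag, ← Fintype.sum_pow fun i => (((x i : ℤˣ) : ℤ) : ℝ), div_pow, zpow_sub₀ hn', zpow_one, zpow_natCast]
  field_simp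

/-! ### Exponential bounds for the model -/

/-- The normalized sum of the weights of the configurations whose average magnetization lies in
`B`. -/
def partialSum (p : ℕ) (b : ℝ) (n : ℕ) (B : Set ℝ) : ℝ :=
  ∑ k ∈ Finset.range (n + 1), (n.choose k : ℝ) / 2 ^ n *
    B.indicator (fun t => Real.exp (b * (n * t ^ p))) (gridPoint n k)

lemma sum_exp_suffStat (p : ℕ) (b : ℝ) {n : ℕ} (hn : 0 < n) (B : Set ℝ) :
    ∑ x : Config n, {x | avgMag n x ∈ B}.indicator (fun x => Real.exp (b * suffStat p n x)) x =
      2 ^ n * partialSum p b n B := by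
  have h := sum_config n (B.indicator fun t => Real.exp (b * (n * t ^ p)))
  rw [partialSum, Finset.mul_sum]
  convert h using 2 with x _ k _
  · by_cases hx : avgMag n x ∈ B <;> simp [hx, suffStat_eq p hn]
  · field_simp

lemma partition_pos (p : ℕ) (b : ℝ) (n : ℕ) : 0 < ∑ y : Config n, Real.exp (b * suffStat p n y) :=
  Finset.sum_pos (fun _ _ => Real.exp_pos _) Finset.univ_nonempty

lemma pmf_pos (p : ℕ) (b : ℝ) (n : ℕ) (x : Config n) : 0 < pmf p b n x :=
  div_pos (Real.exp_pos _) (partition_pos p b n)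

lemma partition_eq (p : ℕ) (b : ℝ) {n : ℕ} (hn : 0 < n) :
    ∑ y : Config n, Real.exp (b * suffStat p n y) = 2 ^ n * partialSum p b n univ := by
  rw [← sum_exp_suffStat p b hn univ]
  simp

lemma partialSum_univ_pos (p : ℕ) (b : ℝ) {n : ℕ} (hn : 0 < n) : 0 < partialSum p b n univ := by
  have h := partition_pos p b n
  rw [partition_eq p b hn] at h
  exact pos_of_mul_pos_right h (by positivity)

lemma prob_avgMag_mem (p : ℕ) (b : ℝ) {n : ℕ} (hn : 0 < n) (B : Set ℝ) :
    prob p b n {x | avgMag n x ∈ B} = partialSum p b n B / partialSum p b n univ := by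
  have h : ∀ x : Config n, {x | avgMag n x ∈ B}.indicator (pmf p b n) x =
      {x | avgMag n x ∈ B}.indicator (fun x => Real.exp (b * suffStat p n x)) x /
        ∑ y : Config n, Real.exp (b * suffStat p n y) := by
    intro x
    by_cases hx : avgMag n x ∈ B <;> simp [hx, pmf]
  simp_rw [prob, h]
  rw [← Finset.sum_div, sum_exp_suffStat p b hn, partition_eq p b hn,
    mul_div_mul_left _ _ (by positivity)]

lemma prob_mono (p : ℕ) (b : ℝ) (n : ℕ) {A B : Set (Config n)} (h : A ⊆ B) :
    prob p b n A ≤ prob p b n B :=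
  Finset.sum_le_sum fun x _ =>
    indicator_le_indicator_of_subset h (fun y => (pmf_pos p b n y).le) x

lemma prob_univ (p : ℕ) (b : ℝ) (n : ℕ) : prob p b n univ = 1 := by
  simp only [prob, indicator_univ, pmf]
  rw [← Finset.sum_div, div_self (partition_pos p b n).ne']

lemma prob_le_one (p : ℕ) (b : ℝ) (n : ℕ) (A : Set (Config n)) : prob p b n A ≤ 1 :=
  prob_univ p b n ▸ prob_mono p b n (subset_univ A)

lemma prob_add_prob_compl (p : ℕ) (b : ℝ) (n : ℕ) (A : Set (Config n)) :
    prob p b n A + prob p b n Aᶜ = 1 := by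
  rw [← prob_univ p b n, prob, prob, prob, ← Finset.sum_add_distrib]
  refine Finset.sum_congr rfl fun x _ => ?_
  by_cases h : x ∈ A <;> simp [h]

lemma exp_mul_hFun (p : ℕ) (b : ℝ) (n : ℕ) (t : ℝ) :
    Real.exp (n * hFun p b t) = Real.exp (-(n * entropyI t)) * Real.exp (b * (n * t ^ p)) := by
  rw [← Real.exp_add, hFun]
  congr 1
  ring

lemma partialSum_le {p : ℕ} {b u : ℝ} {n : ℕ} (hn : 0 < n) {B : Set ℝ}
    (h : ∀ t ∈ B, t ∈ Icc (-1 : ℝ) 1 → hFun p b t ≤ u) :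
    partialSum p b n B ≤ (n + 1) * Real.exp (n * u) := by
  refine (Finset.sum_le_card_nsmul _ _ (Real.exp (n * u)) fun k hk => ?_).trans (by simp)
  have hk' : k ≤ n := Nat.lt_succ_iff.1 (Finset.mem_range.1 hk)
  by_cases hB : gridPoint n k ∈ B
  · rw [indicator_of_mem hB]
    calc (n.choose k : ℝ) / 2 ^ n * Real.exp (b * (n * gridPoint n k ^ p))
        ≤ (2 ^ n * Real.exp (-(n * entropyI (gridPoint n k)))) / 2 ^ n *
          Real.exp (b * (n * gridPoint n k ^ p)) := by
          gcongr
          exact choose_le_exp hn hk'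
      _ = Real.exp (n * hFun p b (gridPoint n k)) := by
          rw [exp_mul_hFun]
          field_simp
      _ ≤ Real.exp (n * u) := by
          gcongr
          exact h _ hB (gridPoint_mem hk')
  · rw [indicator_of_notMem hB, mul_zero]
    positivity

lemma le_partialSum {p : ℕ} {b : ℝ} {n k : ℕ} (hn : 0 < n) (hk : k ≤ n) {B : Set ℝ}
    (hB : gridPoint n k ∈ B) :
    Real.exp (n * hFun p b (gridPoint n k)) ≤ (n + 1) * partialSum p b n B := by
  have h1 : (n.choose k : ℝ) / 2 ^ n * Real.exp (b * (n * gridPoint n k ^ p)) ≤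
      partialSum p b n B := by
    have h := Finset.single_le_sum (f := fun k => (n.choose k : ℝ) / 2 ^ n *
      B.indicator (fun t => Real.exp (b * (n * t ^ p))) (gridPoint n k))
      (fun j _ => mul_nonneg (by positivity) (indicator_nonneg (fun _ _ => (Real.exp_pos _).le) _))
      (Finset.mem_range.2 (Nat.lt_succ_of_le hk))
    rwa [indicator_of_mem hB] at h
  calc Real.exp (n * hFun p b (gridPoint n k))
      = (2 ^ n * Real.exp (-(n * entropyI (gridPoint n k)))) / 2 ^ n *
          Real.exp (b * (n * gridPoint n k ^ p)) := by
        rw [exp_mul_hFun]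
        field_simp
    _ ≤ ((n + 1) * (n.choose k : ℝ)) / 2 ^ n * Real.exp (b * (n * gridPoint n k ^ p)) := by
        gcongr ?_ / _ * _
        exact exp_le_choose hn hk
    _ = (n + 1) * ((n.choose k : ℝ) / 2 ^ n * Real.exp (b * (n * gridPoint n k ^ p))) := by ring
    _ ≤ _ := by gcongr

lemma eventually_exists_gridPoint {r s : ℝ} (hr : 0 ≤ r) (hrs : r < s) (hs : s ≤ 1) :
    ∀ᶠ n : ℕ in atTop, ∃ k ≤ n, gridPoint n k ∈ Ioo r s := by
  have hlim : Tendsto (fun n : ℕ => (n : ℝ) * (s - r)) atTop atTop :=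
    tendsto_natCast_atTop_atTop.atTop_mul_const (sub_pos.2 hrs)
  filter_upwards [eventually_gt_atTop 0, hlim.eventually_gt_atTop 2] with n hn hn2
  have hn' : (0 : ℝ) < n := by exact_mod_cast hn
  -- This is the first index whose grid point lies strictly beyond `r`. The mesh is `2 / n`, less
  -- than `s - r`.
  set k := ⌊n * (1 + r) / 2⌋₊ + 1 with hk
  have h1 : n * (1 + r) / 2 < (k : ℝ) := by
    rw [hk]
    exact_mod_cast Nat.lt_floor_add_one _
  have h2 : (k : ℝ) ≤ n * (1 + r) / 2 + 1 := by
    rw [hk]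
    push_cast
    gcongr
    exact Nat.floor_le (by positivity)
  have h3 : (n : ℝ) * s ≤ n := by nlinarith
  refine ⟨k, ?_, ?_⟩
  · have h4 : (k : ℝ) ≤ n := by nlinarith
    exact_mod_cast h4
  · rw [gridPoint, mem_Ioo, lt_div_iff₀ hn', div_lt_iff₀ hn']
    constructor <;> nlinarith

lemma eventually_sq_le_exp {e : ℝ} (he : 0 < e) :
    ∀ᶠ n : ℕ in atTop, ((n : ℝ) + 1) ^ 2 ≤ Real.exp (n * e) := by
  have h := (isLittleO_pow_exp_pos_mul_atTop 2 he).comp_tendsto tendsto_natCast_atTop_atTop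
  -- The constant `1 / 4` absorbs `(n + 1) ^ 2 ≤ 4 n ^ 2`, valid for `n ≥ 1`.
  have h4 := h.bound (show (0 : ℝ) < 1 / 4 by norm_num)
  filter_upwards [h4, eventually_ge_atTop 1] with n hn hn1
  have hn1' : (1 : ℝ) ≤ n := by exact_mod_cast hn1
  simp only [Function.comp, norm_pow, Real.norm_eq_abs, Real.abs_exp, Nat.abs_cast] at hn
  rw [mul_comm]
  nlinarith

/-- Upper bound for the normalized partition function. -/
lemma partialSum_univ_le {p : ℕ} {c b m : ℝ} (hb : 0 ≤ b) (hm : IsMagnetization p c b m) {n : ℕ}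
    (hn : 0 < n) : partialSum p b n univ ≤ (n + 1) * Real.exp (n * hFun p b m) :=
  partialSum_le hn fun _ _ ht => hm.hFun_le_of_abs_le hb (abs_le.2 ht)

lemma exists_Ioo_hFun_gt {p : ℕ} {b t r l : ℝ} (htr : t < r) (h : l < hFun p b t) :
    ∃ s ∈ Ioo t r, ∀ u ∈ Ioo t s, l < hFun p b u := by
  have h1 : ∀ᶠ u in 𝓝[>] t, l < hFun p b u :=
    ((continuous_hFun p b).continuousAt.eventually (lt_mem_nhds h)).filter_mono nhdsWithin_le_nhds
  obtain ⟨s, hs, h2⟩ := (mem_nhdsGT_iff_exists_Ioo_subset' htr).1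
    (inter_mem h1 (Ioo_mem_nhdsGT htr))
  refine ⟨min s ((t + r) / 2), ⟨lt_min hs (by linarith), (min_le_right _ _).trans_lt
    (by linarith)⟩, fun u hu => (h2 ⟨hu.1, hu.2.trans_le (min_le_left _ _)⟩).1⟩

/-- Exponential upper bound for the probability that the average magnetization lies in `B`. -/
lemma eventually_prob_le {p : ℕ} {c b m : ℝ} (hc : IsTurningPoint p c)
    (hm : IsMagnetization p c b m) {e : ℝ} (he : 0 < e) :
    ∀ᶠ n : ℕ in atTop, ∀ (B : Set ℝ) (u : ℝ),
      (∀ t ∈ B, t ∈ Icc (-1 : ℝ) 1 → hFun p b t ≤ u) →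
        prob p b n {x | avgMag n x ∈ B} ≤ Real.exp (n * (u - hFun p b m + e)) := by
  -- Half of `e` pays for bounding the partition function below by a grid point near `m`, the other
  -- half for the factor `(n + 1) ^ 2`.
  obtain ⟨s, hs, hs2⟩ := exists_Ioo_hFun_gt (p := p) (b := b) (l := hFun p b m - e / 2) hm.mem.2
    (by linarith)
  filter_upwards [eventually_gt_atTop 0, eventually_sq_le_exp (half_pos he),
    eventually_exists_gridPoint (hm.pos hc).le hs.1 hs.2.le] with n hn hn2 hgrid B u hB
  obtain ⟨k, hk, hkm⟩ := hgrid
  have hn' : (0 : ℝ) < n := by exact_mod_cast hn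
  rw [prob_avgMag_mem p b hn, div_le_iff₀ (partialSum_univ_pos p b hn)]
  have h1 := partialSum_le hn hB
  have h2 : Real.exp (n * (hFun p b m - e / 2)) ≤ (n + 1) * partialSum p b n univ := by
    refine le_trans ?_ (le_partialSum hn hk (mem_univ _))
    gcongr
    exact (hs2 _ hkm).le
  refine le_of_mul_le_mul_left ?_ (show (0 : ℝ) < n + 1 by positivity)
  calc (n + 1) * partialSum p b n B ≤ (n + 1) * ((n + 1) * Real.exp (n * u)) := by gcongr
    _ = ((n : ℝ) + 1) ^ 2 * Real.exp (n * u) := by ring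
    _ ≤ Real.exp (n * (e / 2)) * Real.exp (n * u) := by gcongr
    _ = Real.exp (n * (u - hFun p b m + e)) * Real.exp (n * (hFun p b m - e / 2)) := by
        rw [← Real.exp_add, ← Real.exp_add]
        congr 1
        ring
    _ ≤ Real.exp (n * (u - hFun p b m + e)) * ((n + 1) * partialSum p b n univ) := by gcongr
    _ = _ := by ring

/-- Exponential lower bound for the probability that the average magnetization lies in an
interval. -/
lemma eventually_le_prob {p : ℕ} {c b m : ℝ} (hb : 0 ≤ b)
    (hm : IsMagnetization p c b m) {e r s l : ℝ} (he : 0 < e) (hr : 0 ≤ r) (hrs : r < s)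
    (hs : s ≤ 1) (hl : ∀ t ∈ Ioo r s, l ≤ hFun p b t) :
    ∀ᶠ n : ℕ in atTop,
      Real.exp (n * (l - hFun p b m - e)) ≤ prob p b n {x | avgMag n x ∈ Ioo r s} := by
  filter_upwards [eventually_gt_atTop 0, eventually_sq_le_exp he,
    eventually_exists_gridPoint hr hrs hs] with n hn hn2 hgrid
  obtain ⟨k, hk, hkm⟩ := hgrid
  have hn' : (0 : ℝ) < n := by exact_mod_cast hn
  rw [prob_avgMag_mem p b hn, le_div_iff₀ (partialSum_univ_pos p b hn)]
  have h1 : Real.exp (n * l) ≤ (n + 1) * partialSum p b n (Ioo r s) := by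
    refine le_trans ?_ (le_partialSum hn hk hkm)
    gcongr
    exact hl _ hkm
  have h2 := partialSum_univ_le hb hm hn
  refine le_of_mul_le_mul_left ?_ (show (0 : ℝ) < n + 1 by positivity)
  calc (n + 1) * (Real.exp (n * (l - hFun p b m - e)) * partialSum p b n univ)
      ≤ (n + 1) * (Real.exp (n * (l - hFun p b m - e)) *
          ((n + 1) * Real.exp (n * hFun p b m))) := by gcongr
    _ = ((n : ℝ) + 1) ^ 2 * (Real.exp (n * (l - hFun p b m - e)) *
          Real.exp (n * hFun p b m)) := by ring
    _ ≤ Real.exp (n * e) * (Real.exp (n * (l - hFun p b m - e)) *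
          Real.exp (n * hFun p b m)) := by gcongr
    _ = Real.exp (n * l) := by
        rw [← Real.exp_add, ← Real.exp_add]
        congr 1
        ring
    _ ≤ _ := h1

/-! ### Concentration of the magnetization -/

/-- The values of the average magnetization that are `d`-close to `m`, up to the sign if `p` is
even. -/
def nearMag (p : ℕ) (m d : ℝ) : Set ℝ := {t | t ^ p = |t| ^ p ∧ dist |t| m < d}

lemma pow_eq_neg_abs_pow {p : ℕ} {t : ℝ} (h : t ^ p ≠ |t| ^ p) : t ^ p = -|t| ^ p := by
  rw [← abs_pow] at h ⊢
  rcases abs_choice (t ^ p) with h' | h'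
  · exact absurd h'.symm h
  · rw [h', neg_neg]

lemma exists_hFun_le_of_notMem_nearMag {p : ℕ} (hp : 3 ≤ p) {c b m d : ℝ} (hb : 0 ≤ b)
    (hm : IsMagnetization p c b m) (hd : 0 < d) :
    ∃ u < hFun p b m, ∀ t ∈ (nearMag p m d)ᶜ, t ∈ Icc (-1 : ℝ) 1 → hFun p b t ≤ u := by
  have hK : IsCompact (Icc (0 : ℝ) 1 ∩ {t | d ≤ dist t m}) :=
    isCompact_Icc.inter_right (isClosed_le continuous_const (by fun_prop))
  -- Compactness separates `H_b` from its maximum away from `m`. The bound is taken nonnegative so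
  -- that it also covers `t ^ p = -|t| ^ p`, where `H_b ≤ 0`.
  obtain ⟨u, hu0, hu, hKu⟩ : ∃ u, 0 ≤ u ∧ u < hFun p b m ∧
      ∀ t ∈ Icc (0 : ℝ) 1 ∩ {t | d ≤ dist t m}, hFun p b t ≤ u := by
    rcases (Icc (0 : ℝ) 1 ∩ {t | d ≤ dist t m}).eq_empty_or_nonempty with h | h
    · exact ⟨0, le_rfl, hm.hFun_pos, by simp [h]⟩
    · obtain ⟨t, ht, hmax⟩ := hK.exists_isMaxOn h (continuous_hFun p b).continuousOn
      refine ⟨max 0 (hFun p b t), le_max_left _ _, max_lt hm.hFun_pos (hm.hFun_lt t ht.1 ?_),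
        fun s hs => (hmax hs).trans (le_max_right _ _)⟩
      rintro rfl
      have h2 : d ≤ dist t t := ht.2
      rw [dist_self] at h2
      linarith
  refine ⟨u, hu, fun t ht ht1 => ?_⟩
  by_cases hpow : t ^ p = |t| ^ p
  · rw [hFun_eq_abs b hpow]
    refine hKu _ ⟨⟨abs_nonneg t, abs_le.2 ht1⟩, ?_⟩
    by_contra h
    exact ht ⟨hpow, not_le.1 h⟩
  · refine le_trans ?_ hu0
    rw [hFun, pow_eq_neg_abs_pow hpow]
    have h1 := entropyI_nonneg hp ht1
    have h2 : 0 ≤ b * |t| ^ p := by positivity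
    linarith

lemma tendsto_prob_nearMag {p : ℕ} (hp : 3 ≤ p) {c b m d : ℝ} (hb : 0 ≤ b)
    (hc : IsTurningPoint p c) (hm : IsMagnetization p c b m) (hd : 0 < d) :
    Tendsto (fun n => prob p b n {x | avgMag n x ∈ nearMag p m d}) atTop (𝓝 1) := by
  obtain ⟨u, hu, hfar⟩ := exists_hFun_le_of_notMem_nearMag hp hb hm hd
  have hv : 0 < (hFun p b m - u) / 2 := by linarith
  have hlim : Tendsto (fun n : ℕ => 1 - Real.exp (-(n * ((hFun p b m - u) / 2)))) atTop (𝓝 1) := by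
    have h1 : Tendsto (fun n : ℕ => (n : ℝ) * ((hFun p b m - u) / 2)) atTop atTop :=
      tendsto_natCast_atTop_atTop.atTop_mul_const hv
    simpa using (Real.tendsto_exp_neg_atTop_nhds_zero.comp h1).const_sub 1
  refine tendsto_of_tendsto_of_tendsto_of_le_of_le' hlim tendsto_const_nhds ?_
    (Eventually.of_forall fun n => prob_le_one p b n _)
  filter_upwards [eventually_prob_le hc hm hv] with n hn
  have h1 := hn _ u hfar
  have h2 := prob_add_prob_compl p b n {x | avgMag n x ∈ nearMag p m d}
  have h3 : {x : Config n | avgMag n x ∈ nearMag p m d}ᶜ =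
    {x | avgMag n x ∈ (nearMag p m d)ᶜ} := rfl
  rw [show (n : ℝ) * (u - hFun p b m + (hFun p b m - u) / 2) =
    -(n * ((hFun p b m - u) / 2)) by ring] at h1
  rw [h3] at h2
  linarith

/-! ### A criterion for the Bahadur slope -/

/-- Centering and scaling preserve the order, infinite values included, so the `p`-value depends
only on the ordering of the estimates. -/
lemma testStat_lt_iff (est : Estimator) (b : ℝ) {n : ℕ} (hn : 0 < n) (x y : Config n) :
    testStat est b n x < testStat est b n y ↔ est n x < est n y := by
  have hs : 0 < √(n : ℝ) := Real.sqrt_pos.2 (by exact_mod_cast hn)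
  unfold testStat
  generalize est n x = u
  generalize est n y = v
  induction u <;> induction v <;>
    simp only [EReal.bot_sub, EReal.top_sub_coe, EReal.coe_mul_top_of_pos hs,
      EReal.coe_mul_bot_of_pos hs, ← EReal.coe_sub, ← EReal.coe_mul, EReal.coe_lt_coe_iff,
      lt_self_iff_false, bot_lt_top, EReal.bot_lt_coe, EReal.coe_lt_top, not_top_lt, not_lt_bot]
  rw [mul_lt_mul_iff_right₀ hs, sub_lt_sub_iff_right]

lemma pValue_eq (p : ℕ) (est : Estimator) (b : ℝ) {n : ℕ} (hn : 0 < n) (x : Config n) :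
    pValue p est b n x = prob p b n {y | est n x < est n y} := by
  simp only [pValue, testStat_lt_iff est b hn]

/-- If, for configurations with magnetization near `m`, the rejection region of the test is
squeezed between sets on which the rate `H_{b₀,p}` is at most `v + e` and intervals on which it is
at least `v - e`, then the slope is `2 (H_{b₀,p}(m₀) - v)`. -/
theorem isBahadurSlope_of_rate {p : ℕ} (hp : 3 ≤ p) {c b m b₀ m₀ v : ℝ} (hb : 0 ≤ b)
    (hb₀ : 0 ≤ b₀) (hc : IsTurningPoint p c) (hm : IsMagnetization p c b m)
    (hm₀ : IsMagnetization p c b₀ m₀) {est : Estimator}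
    (hup : ∀ e > 0, ∃ d > 0, ∀ (n : ℕ) (x : Config n), 0 < n → avgMag n x ∈ nearMag p m d →
      ∃ B : Set ℝ, (∀ y, est n x < est n y → avgMag n y ∈ B) ∧
        ∀ t ∈ B, t ∈ Icc (-1 : ℝ) 1 → hFun p b₀ t ≤ v + e)
    (hlow : ∀ e > 0, ∃ d > 0, ∃ r s : ℝ, 0 ≤ r ∧ r < s ∧ s ≤ 1 ∧
      (∀ t ∈ Ioo r s, v - e ≤ hFun p b₀ t) ∧ ∀ᶠ n : ℕ in atTop, ∀ x : Config n,
        avgMag n x ∈ nearMag p m d → ∀ y, avgMag n y ∈ Ioo r s → est n x < est n y) :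
    IsBahadurSlope p est b₀ b (2 * (hFun p b₀ m₀ - v)) := by
  intro e he
  have he3 : 0 < e / 3 := by linarith
  obtain ⟨d₁, hd₁, hup⟩ := hup (e / 3) he3
  obtain ⟨d₂, hd₂, r, s, hr, hrs, hs, hl, hlow⟩ := hlow (e / 3) he3
  refine tendsto_of_tendsto_of_tendsto_of_le_of_le'
    (tendsto_prob_nearMag hp hb hc hm (lt_min hd₁ hd₂)) tendsto_const_nhds ?_
    (Eventually.of_forall fun n => prob_le_one p b n _)
  filter_upwards [hlow, eventually_gt_atTop 0, eventually_prob_le hc hm₀ he3,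
    eventually_le_prob hb₀ hm₀ he3 hr hrs hs hl] with n hlow hn hP hQ
  have hn' : (0 : ℝ) < n := by exact_mod_cast hn
  refine prob_mono p b n fun x hx => ?_
  have hx₁ : avgMag n x ∈ nearMag p m d₁ := ⟨hx.1, hx.2.trans_le (min_le_left _ _)⟩
  have hx₂ : avgMag n x ∈ nearMag p m d₂ := ⟨hx.1, hx.2.trans_le (min_le_right _ _)⟩
  obtain ⟨B, hB, hBu⟩ := hup n x hn hx₁
  have h1 : pValue p est b₀ n x ≤ Real.exp (n * (v + e / 3 - hFun p b₀ m₀ + e / 3)) := by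
    rw [pValue_eq p est b₀ hn]
    exact (prob_mono p b₀ n hB).trans (hP B _ hBu)
  have h2 : Real.exp (n * (v - e / 3 - hFun p b₀ m₀ - e / 3)) ≤ pValue p est b₀ n x := by
    rw [pValue_eq p est b₀ hn]
    exact hQ.trans (prob_mono p b₀ n fun y hy => hlow x hx₂ y hy)
  have hpos : 0 < pValue p est b₀ n x := (Real.exp_pos _).trans_le h2
  have h3 := Real.log_le_log hpos h1
  have h4 := Real.log_le_log (Real.exp_pos _) h2
  rw [Real.log_exp] at h3 h4
  have h5 := (div_le_iff₀' hn').2 h3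
  have h6 := (le_div_iff₀' hn').2 h4
  refine ⟨hpos, ?_⟩
  rw [abs_lt]
  constructor <;> linarith

/-- The magnetizations near `m` satisfy, in absolute value, every property that holds near `m`. -/
lemma exists_nearMag_of_eventually {p : ℕ} {m : ℝ} {P : ℝ → Prop} (h : ∀ᶠ s in 𝓝 m, P s) :
    ∃ d > 0, ∀ t ∈ nearMag p m d, t ^ p = |t| ^ p ∧ P |t| := by
  obtain ⟨d, hd, h⟩ := Metric.eventually_nhds_iff.1 h
  exact ⟨d, hd, fun t ht => ⟨ht.1, h ht.2⟩⟩

/-! ### The maximum likelihood estimator -/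

lemma continuous_pmf (p n : ℕ) (x : Config n) : Continuous fun s : ℝ => pmf p s n x := by
  unfold pmf
  exact Continuous.div (by fun_prop) (by fun_prop) fun s => (partition_pos p s n).ne'

lemma differentiable_pmf (p n : ℕ) (x : Config n) :
    Differentiable ℝ fun s : ℝ => pmf p s n x := by
  unfold pmf
  exact Differentiable.div (by fun_prop) (by fun_prop) fun s => (partition_pos p s n).ne'

lemma pmf_eq_mul (p n : ℕ) (s : ℝ) (x y : Config n) :
    pmf p s n y = pmf p s n x * Real.exp (s * (suffStat p n y - suffStat p n x)) := by
  rw [pmf, pmf, div_mul_eq_mul_div, ← Real.exp_add]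
  congr 2
  ring

lemma suffStat_one (p : ℕ) {n : ℕ} (hn : 0 < n) : suffStat p n 1 = n := by
  have hn' : (n : ℝ) ≠ 0 := by exact_mod_cast hn.ne'
  rw [suffStat_eq p hn, avgMag]
  simp [hn']

/-- The all-plus configuration alone contributes `exp (s * n)` to the partition function. So the
likelihood decays at infinity unless the statistic reaches `n`. -/
lemma pmf_le_exp (p : ℕ) {n : ℕ} (hn : 0 < n) (s : ℝ) (x : Config n) :
    pmf p s n x ≤ Real.exp (s * (suffStat p n x - n)) := by
  have h : Real.exp (s * n) ≤ ∑ y : Config n, Real.exp (s * suffStat p n y) := by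
    have h := Finset.single_le_sum (f := fun y : Config n => Real.exp (s * suffStat p n y))
      (fun y _ => (Real.exp_pos _).le) (Finset.mem_univ 1)
    rwa [suffStat_one p hn] at h
  rw [pmf, mul_sub, Real.exp_sub]
  gcongr

lemma exists_isMaxOn_pmf (p : ℕ) {n : ℕ} (hn : 0 < n) {x : Config n} (hx : suffStat p n x < n) :
    ∃ t : ℝ, 0 ≤ t ∧ IsMaxOn (fun s : ℝ => pmf p s n x) (Ici 0) t := by
  have hlim : Tendsto (fun s : ℝ => Real.exp (s * (suffStat p n x - n))) atTop (𝓝 0) :=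
    Real.tendsto_exp_atBot.comp (tendsto_id.atTop_mul_const_of_neg (by linarith))
  obtain ⟨R, hR⟩ := eventually_atTop.1 (hlim.eventually (gt_mem_nhds (pmf_pos p 0 n x)))
  have hR0 : (0 : ℝ) ≤ max R 0 := le_max_right _ _
  obtain ⟨t, ht, hmax⟩ := isCompact_Icc.exists_isMaxOn (nonempty_Icc.2 hR0)
    (continuous_pmf p n x).continuousOn
  refine ⟨t, ht.1, fun s hs => ?_⟩
  by_cases hsR : s ≤ max R 0
  · exact hmax ⟨hs, hsR⟩
  · push Not at hsR
    have h1 := (pmf_le_exp p hn s x).trans (hR s ((le_max_left _ _).trans hsR.le)).le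
    exact h1.trans (hmax (left_mem_Icc.2 hR0))

lemma IsMLE.exists_eq_coe {p n : ℕ} (hn : 0 < n) {x : Config n} {b : EReal}
    (h : IsMLE p n x b) (hx : suffStat p n x < n) :
    ∃ t : ℝ, b = t ∧ 0 ≤ t ∧ IsMaxOn (fun s : ℝ => pmf p s n x) (Ici 0) t :=
  h.resolve_right fun h' => h'.2 (exists_isMaxOn_pmf p hn hx)

/-- Multiplying the two optimality inequalities cancels the partition functions: maximizers in an
exponential family are monotone in the sufficient statistic. -/
lemma mul_sub_suffStat_nonneg {p n : ℕ} {x y : Config n} {a b : ℝ} (ha : 0 ≤ a) (hb : 0 ≤ b)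
    (hx : IsMaxOn (fun s : ℝ => pmf p s n x) (Ici 0) a)
    (hy : IsMaxOn (fun s : ℝ => pmf p s n y) (Ici 0) b) :
    0 ≤ (b - a) * (suffStat p n y - suffStat p n x) := by
  have h1 : pmf p b n x ≤ pmf p a n x := hx hb
  have h2 : pmf p a n y ≤ pmf p b n y := hy ha
  rw [pmf_eq_mul p n a x y, pmf_eq_mul p n b x y] at h2
  have hxa := pmf_pos p a n x
  have h3 : pmf p a n x * Real.exp (a * (suffStat p n y - suffStat p n x)) ≤
      pmf p a n x * Real.exp (b * (suffStat p n y - suffStat p n x)) :=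
    h2.trans (by gcongr)
  have h4 := Real.exp_le_exp.1 (le_of_mul_le_mul_left h3 hxa)
  linarith

lemma IsMLE.suffStat_le {p n : ℕ} (hn : 0 < n) {x y : Config n} {a b : EReal}
    (hx : IsMLE p n x a) (hy : IsMLE p n y b) (hxn : suffStat p n x < n) (h : a < b) :
    suffStat p n x ≤ suffStat p n y := by
  by_contra! hlt
  obtain ⟨s, rfl, hs, hs'⟩ := hx.exists_eq_coe hn hxn
  obtain ⟨t, rfl, ht, ht'⟩ := hy.exists_eq_coe hn (hlt.trans hxn)
  have h1 := mul_sub_suffStat_nonneg hs ht hs' ht'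
  have h2 : s < t := by exact_mod_cast h
  nlinarith

/-- The role of `r` is to keep the estimate for `x` off the boundary point `0`. A common estimate
would then be interior and satisfy both score equations, which differ by a multiple of the gap
between the statistics. -/
lemma IsMLE.lt_of_suffStat_lt {p n : ℕ} (hn : 0 < n) {x y : Config n} {a b : EReal}
    (hx : IsMLE p n x a) (hy : IsMLE p n y b) (hxn : suffStat p n x < n)
    (h : suffStat p n x < suffStat p n y) {r : ℝ} (hr : 0 ≤ r)
    (hr0 : pmf p 0 n x < pmf p r n x) : a < b := by
  obtain ⟨s, rfl, hs, hs'⟩ := hx.exists_eq_coe hn hxn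
  rcases hy with ⟨t, rfl, ht, ht'⟩ | ⟨rfl, -⟩
  swap
  · exact EReal.coe_lt_top s
  have h1 := mul_sub_suffStat_nonneg hs ht hs' ht'
  have hst : s ≤ t := by
    by_contra! h2
    nlinarith
  have hs0 : 0 < s := by
    refine hs.lt_of_ne ?_
    rintro rfl
    exact absurd (hs' hr : pmf p r n x ≤ pmf p 0 n x) (not_le.2 hr0)
  refine EReal.coe_lt_coe_iff.2 (hst.lt_of_ne ?_)
  rintro rfl
  have hdx := (hs'.isLocalMax (Ici_mem_nhds hs0)).deriv_eq_zero
  have hdy := (ht'.isLocalMax (Ici_mem_nhds hs0)).deriv_eq_zero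
  have hD : HasDerivAt (fun s : ℝ => pmf p s n y)
      (0 * Real.exp (s * (suffStat p n y - suffStat p n x)) +
        pmf p s n x * (Real.exp (s * (suffStat p n y - suffStat p n x)) *
          (1 * (suffStat p n y - suffStat p n x)))) s := by
    rw [funext fun s => pmf_eq_mul p n s x y]
    have h2 := (differentiable_pmf p n x s).hasDerivAt
    rw [hdx] at h2
    exact h2.mul (((hasDerivAt_id s).mul_const _).exp)
  rw [hD.deriv, zero_mul, zero_add, one_mul] at hdy
  have : 0 < pmf p s n x * (Real.exp (s * (suffStat p n y - suffStat p n x)) *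
      (suffStat p n y - suffStat p n x)) :=
    mul_pos (pmf_pos p s n x) (mul_pos (Real.exp_pos _) (sub_pos.2 h))
  exact this.ne' hdy

/-- At parameter `0` the law is uniform, while at `b` the normalized partition function is about
`exp (n * H_b m)`, which the weight of `x` exceeds. -/
lemma pmf_zero_lt {p : ℕ} {c b m e : ℝ} (hb : 0 ≤ b) (hm : IsMagnetization p c b m) {n : ℕ}
    (hn : 0 < n) (hn2 : ((n : ℝ) + 1) ^ 2 ≤ Real.exp (n * e)) {x : Config n}
    (hx : hFun p b m + e < b * avgMag n x ^ p) : pmf p 0 n x < pmf p b n x := by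
  have hn' : (0 : ℝ) < n := by exact_mod_cast hn
  have h0 : ∑ y : Config n, Real.exp (0 * suffStat p n y) = 2 ^ n := by simp
  rw [pmf, h0, zero_mul, Real.exp_zero, pmf, partition_eq p b hn,
    div_lt_div_iff₀ (by positivity) (mul_pos (by positivity) (partialSum_univ_pos p b hn)),
    one_mul, mul_comm (Real.exp _), suffStat_eq p hn]
  gcongr
  calc partialSum p b n univ ≤ (n + 1) * Real.exp (n * hFun p b m) := partialSum_univ_le hb hm hn
    _ ≤ ((n : ℝ) + 1) ^ 2 * Real.exp (n * hFun p b m) := by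
        gcongr
        nlinarith
    _ ≤ Real.exp (n * e) * Real.exp (n * hFun p b m) := by gcongr
    _ = Real.exp (n * (hFun p b m + e)) := by
        rw [← Real.exp_add]
        ring_nf
    _ < Real.exp (n * (b * avgMag n x ^ p)) := by gcongr
    _ = Real.exp (b * (n * avgMag n x ^ p)) := by ring_nf

lemma suffStat_lt {p : ℕ} (hp : 3 ≤ p) {n : ℕ} (hn : 0 < n) {x : Config n}
    (hx : |avgMag n x| < 1) : suffStat p n x < n := by
  have hn' : (0 : ℝ) < n := by exact_mod_cast hn
  rw [suffStat_eq p hn]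
  have h1 : avgMag n x ^ p ≤ |avgMag n x| ^ p := (le_abs_self _).trans (abs_pow _ p).le
  have h2 : |avgMag n x| ^ p < 1 := pow_lt_one₀ (abs_nonneg _) hx (by omega)
  nlinarith

section MLE

variable {p : ℕ} {c b m b₀ m₀ : ℝ} {mle : Estimator}

lemma mle_lower_rate (hp : 3 ≤ p) (hb : 0 ≤ b) (hc : IsTurningPoint p c)
    (hm : IsMagnetization p c b m) (hm₀ : IsMagnetization p c b₀ m₀)
    (hmle : ∀ (n : ℕ) (x : Config n), IsMLE p n x (mle n x)) {e : ℝ} (he : 0 < e) :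
    ∃ d > 0, ∃ r s : ℝ, 0 ≤ r ∧ r < s ∧ s ≤ 1 ∧
      (∀ t ∈ Ioo r s, hFun p b₀ (max m m₀) - e ≤ hFun p b₀ t) ∧ ∀ᶠ n : ℕ in atTop,
        ∀ x : Config n, avgMag n x ∈ nearMag p m d → ∀ y, avgMag n y ∈ Ioo r s →
          mle n x < mle n y := by
  have hm0 := hm.pos hc
  obtain ⟨s, hs, hH⟩ := exists_Ioo_hFun_gt (p := p) (b := b₀)
    (l := hFun p b₀ (max m m₀) - e) (max_lt hm.mem.2 hm₀.mem.2) (by linarith)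
  obtain ⟨r, hr⟩ := exists_between hs.1
  have hmr : m < r := (le_max_left _ _).trans_lt hr.1
  have hI : 0 < entropyI m := entropyI_pos hp ⟨hm0, hm.mem.2.le⟩
  -- Since `b * m ^ p = H_b m + I m`, the entropy supplies the margin by which the likelihood at `b`
  -- beats that at `0`.
  have hpow : ∀ᶠ t in 𝓝 m, hFun p b m + entropyI m / 2 < b * t ^ p := by
    have hcont : Continuous fun t : ℝ => b * t ^ p := by fun_prop
    exact hcont.continuousAt.eventually (lt_mem_nhds (by rw [hFun]; linarith))
  obtain ⟨d, hd, hnear⟩ := exists_nearMag_of_eventually (p := p)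
    ((hpow.and (gt_mem_nhds hmr)).and (gt_mem_nhds hm.mem.2))
  refine ⟨d, hd, r, s, (hm0.trans hmr).le, hr.2, hs.2.le,
    fun t ht => (hH t ⟨hr.1.trans ht.1, ht.2⟩).le, ?_⟩
  filter_upwards [eventually_gt_atTop 0, eventually_sq_le_exp (half_pos hI)] with n hn hn2 x hx y hy
  have hn' : (0 : ℝ) < n := by exact_mod_cast hn
  obtain ⟨hxp, ⟨hx1, hx2⟩, hx3⟩ := hnear _ hx
  refine (hmle n x).lt_of_suffStat_lt hn (hmle n y) (suffStat_lt hp hn hx3) ?_ hb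
    (pmf_zero_lt hb hm hn hn2 (by rwa [hxp]))
  rw [suffStat_eq p hn, suffStat_eq p hn, hxp]
  have := pow_lt_pow_left₀ (hx2.trans hy.1) (abs_nonneg _) (by omega : p ≠ 0)
  gcongr

lemma mle_upper_rate (hp : 3 ≤ p) (hb₀ : 0 ≤ b₀) (hc : IsTurningPoint p c)
    (hm : IsMagnetization p c b m) (hm₀ : IsMagnetization p c b₀ m₀) (hlt : b₀ < b)
    (hmle : ∀ (n : ℕ) (x : Config n), IsMLE p n x (mle n x)) {e : ℝ} (he : 0 < e) :
    ∃ d > 0, ∀ (n : ℕ) (x : Config n), 0 < n → avgMag n x ∈ nearMag p m d →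
      ∃ B : Set ℝ, (∀ y, mle n x < mle n y → avgMag n y ∈ B) ∧
        ∀ t ∈ B, t ∈ Icc (-1 : ℝ) 1 → hFun p b₀ t ≤ hFun p b₀ m + e := by
  have hmm := hm₀.lt_of_lt hc hm hlt
  have hH : ∀ᶠ t in 𝓝 m, hFun p b₀ t < hFun p b₀ m + e :=
    (continuous_hFun p b₀).continuousAt.eventually (gt_mem_nhds (by linarith))
  obtain ⟨d, hd, hnear⟩ := exists_nearMag_of_eventually (p := p)
    ((hH.and (lt_mem_nhds hmm)).and (gt_mem_nhds hm.mem.2))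
  refine ⟨d, hd, fun n x hn hx => ?_⟩
  obtain ⟨hxp, ⟨hx1, hx2⟩, hx3⟩ := hnear _ hx
  refine ⟨{t | |avgMag n x| ≤ |t|}, fun y hy => ?_, fun t ht ht1 => ?_⟩
  · have hn' : (0 : ℝ) < n := by exact_mod_cast hn
    have h := (hmle n x).suffStat_le hn (hmle n y) (suffStat_lt hp hn hx3) hy
    rw [suffStat_eq p hn, suffStat_eq p hn, hxp] at h
    have h1 := (le_of_mul_le_mul_left h hn').trans ((le_abs_self _).trans (abs_pow _ p).le)
    exact le_of_pow_le_pow_left₀ (by omega : p ≠ 0) (abs_nonneg _) h1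
  · have ht' : |avgMag n x| ≤ |t| := ht
    exact (hFun_le_abs p hb₀ t).trans (((hm₀.strictAntiOn hp hc).antitoneOn
      ⟨hx2.le, hx3.le⟩ ⟨hx2.le.trans ht', abs_le.2 ht1⟩ ht').trans hx1.le)

/-- The Bahadur slope of the maximum likelihood estimator. -/
theorem isBahadurSlope_mle (hp : 3 ≤ p) (hb : 0 ≤ b) (hb₀ : 0 ≤ b₀) (hc : IsTurningPoint p c)
    (hm : IsMagnetization p c b m) (hm₀ : IsMagnetization p c b₀ m₀)
    (hmle : ∀ (n : ℕ) (x : Config n), IsMLE p n x (mle n x)) :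
    IsBahadurSlope p mle b₀ b (2 * (hFun p b₀ m₀ - hFun p b₀ (max m m₀))) := by
  refine isBahadurSlope_of_rate hp hb hb₀ hc hm hm₀ (fun e he => ?_)
    fun e he => mle_lower_rate hp hb hc hm hm₀ hmle he
  rcases lt_or_ge m₀ m with h | h
  · rw [max_eq_left h.le]
    refine mle_upper_rate hp hb₀ hc hm hm₀ ?_ hmle he
    rw [← hm.etaReal_eq, ← hm₀.etaReal_eq]
    exact hc.strictMonoOn ⟨hm₀.mem.1.le, hm₀.mem.2⟩ ⟨hm.mem.1.le, hm.mem.2⟩ h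
  · rw [max_eq_right h]
    -- Here the slope is `0`, and the global maximum of `H_{b₀}` already bounds the rate.
    exact ⟨1, one_pos, fun n x _ _ => ⟨univ, fun _ _ => mem_univ _, fun t _ ht =>
      (hm₀.hFun_le_of_abs_le hb₀ (abs_le.2 ht)).trans (by linarith)⟩⟩

end MLE

/-! ### The maximum pseudolikelihood estimator -/

lemma artanh_neg_eq {t : ℝ} (ht : t ∈ Ioo (-1 : ℝ) 1) : Real.artanh (-t) = -Real.artanh t := by
  have h1 : 1 + t ≠ 0 := by linarith [ht.1]
  have h2 : 1 - t ≠ 0 := by linarith [ht.2]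
  rw [Real.artanh_eq_half_log ⟨by linarith [ht.2], by linarith [ht.1]⟩,
    Real.artanh_eq_half_log ⟨ht.1.le, ht.2.le⟩, sub_neg_eq_add, ← sub_eq_add_neg,
    Real.log_div h1 h2, Real.log_div h2 h1]
  ring

lemma eta_eq_coe (p : ℕ) {t : ℝ} (h0 : t ≠ 0) (ht : t ∈ Ioo (-1 : ℝ) 1) :
    eta p t = ((p : ℝ)⁻¹ * t ^ (1 - (p : ℤ)) * Real.artanh t : ℝ) := by
  rw [eta, if_neg h0, artanhExt, if_neg ht.2.ne, if_neg ht.1.ne', EReal.coe_mul _ (Real.artanh t)]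

lemma eta_eq_etaReal {p : ℕ} (hp : 3 ≤ p) {t : ℝ} (ht : t ∈ Ioo (0 : ℝ) 1) :
    eta p t = (etaReal p t : ℝ) := by
  rw [eta_eq_coe p ht.1.ne' ⟨by linarith [ht.1], ht.2⟩, etaReal,
    show (1 - (p : ℤ)) = -((p - 1 : ℕ) : ℤ) by omega, zpow_neg, zpow_natCast, ← mul_inv,
    div_eq_mul_inv, mul_comm]

lemma eta_zero (p : ℕ) : eta p 0 = 0 := by simp [eta]

lemma eta_one {p : ℕ} (hp : 3 ≤ p) : eta p 1 = ⊤ := by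
  have hp0 : (0 : ℝ) < p := by exact_mod_cast (by omega : 0 < p)
  rw [eta, if_neg one_ne_zero, artanhExt, if_pos rfl, one_zpow, mul_one,
    EReal.coe_mul_top_of_pos (inv_pos.2 hp0)]

lemma eta_neg_of_even {p : ℕ} (hp : 3 ≤ p) (he : Even p) {t : ℝ} (ht : t ∈ Ioc (0 : ℝ) 1) :
    eta p (-t) = eta p t := by
  have hp0 : (0 : ℝ) < p := by exact_mod_cast (by omega : 0 < p)
  have ho : Odd (1 - (p : ℤ)) := by
    rw [Int.odd_sub']
    simpa using he
  rcases ht.2.eq_or_lt with rfl | h1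
  · rw [eta_one hp, eta, if_neg (by norm_num), artanhExt, if_neg (by norm_num), if_pos rfl,
      ho.neg_zpow, one_zpow, mul_neg_one, EReal.coe_mul_bot_of_neg (neg_neg_of_pos (inv_pos.2 hp0))]
  · have htm : t ∈ Ioo (-1 : ℝ) 1 := ⟨by linarith [ht.1], h1⟩
    rw [eta_eq_coe p ht.1.ne' htm, eta_eq_coe p (neg_ne_zero.2 ht.1.ne')
      ⟨by linarith [htm.2], by linarith [htm.1]⟩, artanh_neg_eq htm, ho.neg_zpow]
    congr 1
    ring

lemma eta_neg_nonpos_of_odd {p : ℕ} (hp : 3 ≤ p) (ho : Odd p) {t : ℝ} (ht : t ∈ Ioc (0 : ℝ) 1) :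
    eta p (-t) ≤ 0 := by
  have hp0 : (0 : ℝ) < p := by exact_mod_cast (by omega : 0 < p)
  have he : Even (1 - (p : ℤ)) := by
    rw [Int.even_sub']
    simpa using ho
  rcases ht.2.eq_or_lt with rfl | h1
  · rw [eta, if_neg (by norm_num), artanhExt, if_neg (by norm_num), if_pos rfl,
      he.neg_zpow, one_zpow, mul_one, EReal.coe_mul_bot_of_pos (inv_pos.2 hp0)]
    exact bot_le
  · have htm : t ∈ Ioo (-1 : ℝ) 1 := ⟨by linarith [ht.1], h1⟩
    rw [eta_eq_coe p (neg_ne_zero.2 ht.1.ne')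
      ⟨by linarith [htm.2], by linarith [htm.1]⟩, he.neg_zpow]
    have h2 : Real.artanh (-t) ≤ 0 := Real.artanh_nonpos (by linarith [ht.1])
    have h3 : 0 ≤ (p : ℝ)⁻¹ * t ^ (1 - (p : ℤ)) :=
      mul_nonneg (inv_nonneg.2 hp0.le) (zpow_nonneg ht.1.le _)
    exact_mod_cast mul_nonpos_of_nonneg_of_nonpos h3 h2

lemma eta_nonneg {p : ℕ} (hp : 3 ≤ p) {t : ℝ} (ht : t ∈ Icc (0 : ℝ) 1) : 0 ≤ eta p t := by
  rcases ht.1.eq_or_lt with rfl | h0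
  · rw [eta_zero]
  rcases ht.2.eq_or_lt with rfl | h1
  · rw [eta_one hp]
    exact le_top
  · rw [eta_eq_etaReal hp ⟨h0, h1⟩]
    exact_mod_cast (etaReal_pos hp ⟨h0, h1⟩).le

/-- For even `p`, `η_p` is even; for odd `p` it is nonpositive at negative arguments. -/
lemma eta_le_eta_abs {p : ℕ} (hp : 3 ≤ p) {t : ℝ} (ht : |t| ≤ 1) : eta p t ≤ eta p |t| := by
  rcases le_or_gt 0 t with h | h
  · rw [abs_of_nonneg h]
  have h1 : |t| ∈ Ioc (0 : ℝ) 1 := ⟨abs_pos.2 h.ne, ht⟩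
  rw [show t = -|t| by rw [abs_of_neg h, neg_neg], abs_neg, abs_abs]
  rcases p.even_or_odd with he | ho
  · exact (eta_neg_of_even hp he h1).le
  · exact (eta_neg_nonpos_of_odd hp ho h1).trans (eta_nonneg hp ⟨h1.1.le, h1.2⟩)

lemma eta_eq_eta_abs {p : ℕ} (hp : 3 ≤ p) {t : ℝ} (ht : |t| ≤ 1) (h : t ^ p = |t| ^ p) :
    eta p t = eta p |t| := by
  rcases le_or_gt 0 t with h0 | h0
  · rw [abs_of_nonneg h0]
  have h1 : |t| ∈ Ioc (0 : ℝ) 1 := ⟨abs_pos.2 h0.ne, ht⟩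
  have he : Even p := by
    by_contra ho
    have h2 := (Nat.not_even_iff_odd.1 ho).pow_neg h0
    have h3 := pow_pos h1.1 p
    linarith
  nth_rewrite 1 [show t = -|t| by rw [abs_of_neg h0, neg_neg]]
  exact eta_neg_of_even hp he h1

section MPLE

variable {p : ℕ} {c b m b₀ m₀ : ℝ}

lemma mple_lower_rate (hp : 3 ≤ p) (hc : IsTurningPoint p c)
    (hm : IsMagnetization p c b m) (hm₀ : IsMagnetization p c b₀ m₀) {e : ℝ} (he : 0 < e) :
    ∃ d > 0, ∃ r s : ℝ, 0 ≤ r ∧ r < s ∧ s ≤ 1 ∧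
      (∀ t ∈ Ioo r s, hFun p b₀ (max m m₀) - e ≤ hFun p b₀ t) ∧ ∀ᶠ n : ℕ in atTop,
        ∀ x : Config n, avgMag n x ∈ nearMag p m d → ∀ y, avgMag n y ∈ Ioo r s →
          mple p n x < mple p n y := by
  have hm0 := hm.pos hc
  obtain ⟨s, hs, hH⟩ := exists_Ioo_hFun_gt (p := p) (b := b₀)
    (l := hFun p b₀ (max m m₀) - e) (max_lt hm.mem.2 hm₀.mem.2) (by linarith)
  obtain ⟨r, hr⟩ := exists_between hs.1
  have hmr : m < r := (le_max_left _ _).trans_lt hr.1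
  obtain ⟨d, hd, hnear⟩ := exists_nearMag_of_eventually (p := p)
    ((lt_mem_nhds hm.mem.1).and (gt_mem_nhds hmr))
  refine ⟨d, hd, r, s, (hm0.trans hmr).le, hr.2, hs.2.le,
    fun t ht => (hH t ⟨hr.1.trans ht.1, ht.2⟩).le, Eventually.of_forall fun n x hx y hy => ?_⟩
  obtain ⟨hxp, hx1, hx2⟩ := hnear _ hx
  have hy1 : avgMag n y < 1 := hy.2.trans hs.2
  have hxy : |avgMag n x| < avgMag n y := hx2.trans hy.1
  have hc0 := hc.mem.1
  rw [mple, mple, eta_eq_eta_abs hp (abs_avgMag_le_one x) hxp,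
    eta_eq_etaReal hp ⟨hc0.trans hx1, hxy.trans hy1⟩,
    eta_eq_etaReal hp ⟨(hc0.trans hx1).trans hxy, hy1⟩, EReal.coe_lt_coe_iff]
  exact hc.strictMonoOn ⟨hx1.le, hxy.trans hy1⟩ ⟨(hx1.trans hxy).le, hy1⟩ hxy

/-- Small positive magnetizations give arbitrarily large pseudolikelihood estimates, and their rate
is near `H_{b₀} 0 = 0`. This is the source of `max 0` in the slope. -/
lemma mple_lower_rate_zero (hp : 3 ≤ p) (b₀ : ℝ) (hc : IsTurningPoint p c)
    (hm : IsMagnetization p c b m) {e : ℝ} (he : 0 < e) :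
    ∃ d > 0, ∃ r s : ℝ, 0 ≤ r ∧ r < s ∧ s ≤ 1 ∧
      (∀ t ∈ Ioo r s, 0 - e ≤ hFun p b₀ t) ∧ ∀ᶠ n : ℕ in atTop,
        ∀ x : Config n, avgMag n x ∈ nearMag p m d → ∀ y, avgMag n y ∈ Ioo r s →
          mple p n x < mple p n y := by
  have hm0 := hm.pos hc
  obtain ⟨q, hq, hqe⟩ := exists_forall_lt_etaReal hp (etaReal p m + 1)
  obtain ⟨s, hs, hH⟩ := exists_Ioo_hFun_gt (p := p) (b := b₀) (t := 0) (l := 0 - e) hq.1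
    (by rw [hFun_zero hp]; linarith)
  have hs1 : s < 1 := hs.2.trans hq.2
  have hη : ∀ᶠ t in 𝓝 m, etaReal p t < etaReal p m + 1 :=
    ((continuousOn_etaReal hp).continuousAt (Ioo_mem_nhds hm0 hm.mem.2)).eventually
      (gt_mem_nhds (by linarith))
  obtain ⟨d, hd, hnear⟩ := exists_nearMag_of_eventually (p := p)
    (hη.and (Ioo_mem_nhds hm0 hm.mem.2))
  refine ⟨d, hd, 0, s, le_rfl, hs.1, hs1.le, fun t ht => (hH t ht).le,
    Eventually.of_forall fun n x hx y hy => ?_⟩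
  obtain ⟨hxp, hx1, hx2⟩ := hnear _ hx
  rw [mple, mple, eta_eq_eta_abs hp (abs_avgMag_le_one x) hxp, eta_eq_etaReal hp hx2,
    eta_eq_etaReal hp ⟨hy.1, hy.2.trans hs1⟩, EReal.coe_lt_coe_iff]
  exact hx1.trans (hqe _ ⟨hy.1, hy.2.trans hs.2⟩)

lemma mple_upper_rate (hp : 3 ≤ p) (hb₀ : 0 ≤ b₀) (hc : IsTurningPoint p c)
    (hm : IsMagnetization p c b m) (hm₀ : IsMagnetization p c b₀ m₀) (hlt : b₀ < b)
    {e : ℝ} (he : 0 < e) :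
    ∃ d > 0, ∀ (n : ℕ) (x : Config n), 0 < n → avgMag n x ∈ nearMag p m d →
      ∃ B : Set ℝ, (∀ y, mple p n x < mple p n y → avgMag n y ∈ B) ∧
        ∀ t ∈ B, t ∈ Icc (-1 : ℝ) 1 → hFun p b₀ t ≤ max 0 (hFun p b₀ m) + e := by
  have hm0 := hm.pos hc
  have hmm := hm₀.lt_of_lt hc hm hlt
  have hH : ∀ᶠ t in 𝓝 m, hFun p b₀ t < hFun p b₀ m + e :=
    (continuous_hFun p b₀).continuousAt.eventually (gt_mem_nhds (by linarith))
  obtain ⟨d, hd, hnear⟩ := exists_nearMag_of_eventually (p := p)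
    ((hH.and (lt_mem_nhds hmm)).and (gt_mem_nhds hm.mem.2))
  refine ⟨d, hd, fun n x hn hx => ?_⟩
  obtain ⟨hxp, ⟨hx1, hx2⟩, hx3⟩ := hnear _ hx
  have hcx : c < |avgMag n x| := hm₀.mem.1.trans hx2
  have hx0 : 0 < |avgMag n x| := hc.mem.1.trans hcx
  have hbx : b₀ < etaReal p |avgMag n x| := by
    rw [← hm₀.etaReal_eq]
    exact hc.strictMonoOn ⟨hm₀.mem.1.le, hm₀.mem.2⟩ ⟨hcx.le, hx3⟩ hx2
  -- A larger estimate comes either from a larger `|t|`, where `H_{b₀}` decreases, or from the left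
  -- branch of `η_p`, where `η_p > b₀` forces `H_{b₀} < 0`. The second alternative also admits the
  -- value `0`.
  refine ⟨{t | |avgMag n x| ≤ |t| ∨ hFun p b₀ |t| ≤ 0}, fun y hy => ?_, fun t ht ht1 => ?_⟩
  · by_cases hle : |avgMag n x| ≤ |avgMag n y|
    · exact Or.inl hle
    push Not at hle
    right
    rw [mple, mple, eta_eq_eta_abs hp (abs_avgMag_le_one x) hxp, eta_eq_etaReal hp ⟨hx0, hx3⟩] at hy
    have hy' := hy.trans_le (eta_le_eta_abs hp (abs_avgMag_le_one y))
    have hxpos := etaReal_pos hp ⟨hx0, hx3⟩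
    rcases (abs_nonneg (avgMag n y)).eq_or_lt with h0 | h0
    · rw [← h0, eta_zero] at hy'
      exact absurd (by exact_mod_cast hy' : etaReal p |avgMag n x| < 0) hxpos.le.not_gt
    rw [eta_eq_etaReal hp ⟨h0, hle.trans hx3⟩, EReal.coe_lt_coe_iff] at hy'
    rcases le_or_gt |avgMag n y| c with hyc | hyc
    · exact (hFun_neg_of_lt_etaReal hp hc ⟨h0, hyc⟩ (hbx.trans hy').le).le
    · exact absurd (hc.strictMonoOn ⟨hyc.le, hle.trans hx3⟩ ⟨hcx.le, hx3⟩ hle) hy'.not_gt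
  · refine (hFun_le_abs p hb₀ t).trans ?_
    rcases ht with ht | ht
    · have h1 := ((hm₀.strictAntiOn hp hc).antitoneOn
        ⟨hx2.le, hx3.le⟩ ⟨hx2.le.trans ht, abs_le.2 ht1⟩ ht).trans hx1.le
      linarith [le_max_right 0 (hFun p b₀ m)]
    · linarith [le_max_left 0 (hFun p b₀ m)]

/-- The Bahadur slope of the maximum pseudolikelihood estimator. -/
theorem isBahadurSlope_mple (hp : 3 ≤ p) (hb : 0 ≤ b) (hb₀ : 0 ≤ b₀) (hc : IsTurningPoint p c)
    (hm : IsMagnetization p c b m) (hm₀ : IsMagnetization p c b₀ m₀) :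
    IsBahadurSlope p (mple p) b₀ b
      (2 * (hFun p b₀ m₀ - max 0 (hFun p b₀ (max m m₀)))) := by
  refine isBahadurSlope_of_rate hp hb hb₀ hc hm hm₀ (fun e he => ?_) fun e he => ?_
  · rcases lt_or_ge m₀ m with h | h
    · rw [max_eq_left h.le]
      refine mple_upper_rate hp hb₀ hc hm hm₀ ?_ he
      rw [← hm.etaReal_eq, ← hm₀.etaReal_eq]
      exact hc.strictMonoOn ⟨hm₀.mem.1.le, hm₀.mem.2⟩ ⟨hm.mem.1.le, hm.mem.2⟩ h
    · rw [max_eq_right h, max_eq_right hm₀.hFun_pos.le]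
      exact ⟨1, one_pos, fun n x _ _ => ⟨univ, fun _ _ => mem_univ _, fun t _ ht =>
        (hm₀.hFun_le_of_abs_le hb₀ (abs_le.2 ht)).trans (by linarith)⟩⟩
  · rcases le_total (hFun p b₀ (max m m₀)) 0 with h | h
    · rw [max_eq_left h]
      exact mple_lower_rate_zero hp b₀ hc hm he
    · rw [max_eq_right h]
      exact mple_lower_rate hp hc hm hm₀ he

end MPLE

end CurieWeiss

end

/-! ### Comparison of the slopes. -/

theorem theorem4 (p : ℕ) (hp : 3 ≤ p) (β : ℝ) (hβ : CurieWeiss.betaStar p < β)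
    (mle : CurieWeiss.Estimator)
    (hmle : ∀ (n : ℕ) (x : CurieWeiss.Config n), CurieWeiss.IsMLE p n x (mle n x)) :
    ∃ (m : ℝ) (cMPL cML : ℝ → ℝ),
      CurieWeiss.posMaximizers p β = {m} ∧
      (∀ β₀ : ℝ, CurieWeiss.betaStar p < β₀ →
        CurieWeiss.IsBahadurSlope p (CurieWeiss.mple p) β₀ β (cMPL β₀) ∧
        CurieWeiss.IsBahadurSlope p mle β₀ β (cML β₀)) ∧
      (∀ β₀ ∈ Ioo (CurieWeiss.betaStar p) β, 0 < cMPL β₀ ∧ 0 < cML β₀) ∧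
      {β₀ : ℝ | CurieWeiss.betaStar p < β₀ ∧ 0 < cMPL β₀ ∧
          1 < CurieWeiss.bahadurARE (cML β₀) (cMPL β₀)} =
        Ioo (CurieWeiss.betaStar p) (CurieWeiss.entropyI m / m ^ p) ∧
      CurieWeiss.hFun p (CurieWeiss.betaStar p) m < 0 ∧
      (∀ δ ∈ Ioo (0 : ℝ) 1,
        Tendsto (fun β₀ => CurieWeiss.asympSampleSize δ (cMPL β₀))
          (𝓝[>] CurieWeiss.betaStar p) atTop ∧
        Tendsto (fun β₀ => CurieWeiss.asympSampleSize δ (cML β₀))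
          (𝓝[>] CurieWeiss.betaStar p)
          (𝓝 (Real.log δ / CurieWeiss.hFun p (CurieWeiss.betaStar p) m))) ∧
      Tendsto (fun β₀ => CurieWeiss.bahadurARE (cML β₀) (cMPL β₀))
        (𝓝[>] CurieWeiss.betaStar p) atTop := by
  open CurieWeiss in
  obtain ⟨c, hc⟩ := exists_isTurningPoint hp
  choose! mag hmag using fun (b : ℝ) (hb : betaStar p < b) => exists_isMagnetization hp hc hb
  have hnn : ∀ b, betaStar p < b → 0 ≤ b := fun b hb => (betaStar_nonneg hp).trans hb.le
  set m := mag β with hmdef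
  have hm : IsMagnetization p c β m := hmag β hβ
  have hm0 : 0 < m := hm.pos hc
  have hmp : 0 < m ^ p := pow_pos hm0 p
  have hneg : hFun p (betaStar p) m < 0 := hm.hFun_betaStar_neg hp hc hβ
  have hmax : ∀ b ∈ Ioo (betaStar p) β, max m (mag b) = m := fun b hb =>
    max_eq_left ((hmag b hb.1).lt_of_lt hc hm hb.2).le
  have hlt : ∀ b ∈ Ioo (betaStar p) β, hFun p b m < hFun p b (mag b) := fun b hb =>
    (hmag b hb.1).hFun_lt m ⟨hm0.le, hm.mem.2.le⟩ ((hmag b hb.1).lt_of_lt hc hm hb.2).ne'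
  set cMPL : ℝ → ℝ := fun b =>
    2 * (hFun p b (mag b) - max 0 (hFun p b (max m (mag b)))) with hcMPL
  set cML : ℝ → ℝ := fun b => 2 * (hFun p b (mag b) - hFun p b (max m (mag b))) with hcML
  have hMPL : ∀ b ∈ Ioo (betaStar p) β,
      cMPL b = 2 * (hFun p b (mag b) - max 0 (hFun p b m)) := fun b hb => by
    simp only [hcMPL, hmax b hb]
  have hML : ∀ b ∈ Ioo (betaStar p) β, cML b = 2 * (hFun p b (mag b) - hFun p b m) :=
    fun b hb => by simp only [hcML, hmax b hb]
  have hMPLpos : ∀ b ∈ Ioo (betaStar p) β, 0 < cMPL b := fun b hb => by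
    have := max_lt (hmag b hb.1).hFun_pos (hlt b hb)
    rw [hMPL b hb]
    linarith
  have hIdiv : ∀ b, hFun p b m < 0 ↔ b < entropyI m / m ^ p := fun b => by
    rw [hFun, lt_div_iff₀ hmp, sub_neg]
  have hIβ : entropyI m / m ^ p < β := by
    have := hm.hFun_pos
    rw [hFun] at this
    rw [div_lt_iff₀ hmp]
    linarith
  have hnear : ∀ᶠ b in 𝓝[>] betaStar p, b ∈ Ioo (betaStar p) β := Ioo_mem_nhdsGT hβ
  have hid : Tendsto (fun b : ℝ => b) (𝓝[>] betaStar p) (𝓝 (betaStar p)) :=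
    tendsto_id.mono_left nhdsWithin_le_nhds
  have hHm : Tendsto (fun b => hFun p b m) (𝓝[>] betaStar p) (𝓝 (hFun p (betaStar p) m)) :=
    (hid.mul_const _).sub_const _
  -- Squeeze: since `H_{β*} ≤ 0` on `[0,1]` and `(mag b) ^ p ≤ 1`, the maximum of `H_b` is at most
  -- `b - betaStar p`.
  have hHmag : Tendsto (fun b => hFun p b (mag b)) (𝓝[>] betaStar p) (𝓝 0) := by
    have hb : Tendsto (fun b : ℝ => b - betaStar p) (𝓝[>] betaStar p) (𝓝 0) := by
      simpa using hid.sub_const (betaStar p)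
    refine tendsto_of_tendsto_of_tendsto_of_le_of_le' tendsto_const_nhds hb ?_ ?_
    · filter_upwards [hnear] with b hb using (hmag b hb.1).hFun_pos.le
    · filter_upwards [hnear] with b hb
      have h1 := hmag b hb.1
      have h2 := hFun_betaStar_nonpos hp (t := mag b) ⟨(h1.pos hc).le, h1.mem.2.le⟩
      have h3 : mag b ^ p ≤ 1 := pow_le_one₀ (h1.pos hc).le h1.mem.2.le
      rw [hFun_sub p b (betaStar p)]
      nlinarith [hb.1]
  have hlimML : Tendsto cML (𝓝[>] betaStar p) (𝓝 (2 * (0 - hFun p (betaStar p) m))) := by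
    refine ((hHmag.sub hHm).const_mul 2).congr' ?_
    filter_upwards [hnear] with b hb using (hML b hb).symm
  have hlimMPL : Tendsto cMPL (𝓝[>] betaStar p) (𝓝[>] 0) := by
    refine tendsto_nhdsWithin_iff.2 ⟨?_, ?_⟩
    · have h := ((hHmag.sub (tendsto_const_nhds.max hHm)).const_mul 2 :
        Tendsto (fun b => 2 * (hFun p b (mag b) - max 0 (hFun p b m))) (𝓝[>] betaStar p) _)
      rw [max_eq_left hneg.le, sub_zero, mul_zero] at h
      refine h.congr' ?_
      filter_upwards [hnear] with b hb using (hMPL b hb).symm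
    · filter_upwards [hnear] with b hb using hMPLpos b hb
  have hinv : Tendsto (fun b => (cMPL b)⁻¹) (𝓝[>] betaStar p) atTop :=
    tendsto_inv_nhdsGT_zero.comp hlimMPL
  refine ⟨m, cMPL, cML, hm.posMaximizers_eq hc (hnn β hβ), fun b hb =>
    ⟨isBahadurSlope_mple hp (hnn β hβ) (hnn b hb) hc hm (hmag b hb),
      isBahadurSlope_mle hp (hnn β hβ) (hnn b hb) hc hm (hmag b hb) hmle⟩, fun b hb =>
    ⟨hMPLpos b hb, ?_⟩, ?_, hneg, fun δ hδ => ⟨?_, ?_⟩, ?_⟩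
  · rw [hML b hb]
    linarith [hlt b hb]
  · ext b
    constructor
    · rintro ⟨hb, hpos, hare⟩
      refine ⟨hb, ?_⟩
      rw [bahadurARE, one_lt_div hpos] at hare
      -- For `b ≥ β` the maximizer at `b` is at least `m`, so the MPL slope is `0`.
      have hbβ : b < β := by
        by_contra! hle
        have hle' : m ≤ mag b := by
          rcases hle.eq_or_lt with rfl | h
          · exact hmdef.le
          · exact (hm.lt_of_lt hc (hmag b hb) h).le
        simp only [hcMPL, max_eq_right hle', max_eq_right (hmag b hb).hFun_pos.le, sub_self,
          mul_zero, lt_self_iff_false] at hpos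
      rw [← hIdiv]
      -- When `H_b m ≥ 0` the maximum with `0` has no effect and the two slopes coincide.
      by_contra! h
      rw [hMPL b ⟨hb, hbβ⟩, hML b ⟨hb, hbβ⟩, max_eq_right h] at hare
      exact lt_irrefl _ hare
    · rintro ⟨hb, hbI⟩
      have hb' : b ∈ Ioo (betaStar p) β := ⟨hb, hbI.trans hIβ⟩
      refine ⟨hb, hMPLpos b hb', ?_⟩
      have h := (hIdiv b).2 hbI
      rw [bahadurARE, one_lt_div (hMPLpos b hb'), hMPL b hb', hML b hb', max_eq_left h.le]
      linarith
  · have hlog : 0 < -2 * Real.log δ := by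
      have := Real.log_neg hδ.1 hδ.2
      linarith
    exact hinv.const_mul_atTop hlog
  · have hne : 2 * (0 - hFun p (betaStar p) m) ≠ 0 := by
      intro h
      linarith
    have h := (tendsto_const_nhds (x := -2 * Real.log δ)).div hlimML hne
    have he : -2 * Real.log δ / (2 * (0 - hFun p (betaStar p) m)) =
        Real.log δ / hFun p (betaStar p) m := by
      rw [show 2 * (0 - hFun p (betaStar p) m) = -2 * hFun p (betaStar p) m by ring,
        mul_div_mul_left _ _ (by norm_num)]
    rw [he] at h
    exact h
  · have hpos : 0 < 2 * (0 - hFun p (betaStar p) m) := by linarith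
    exact hlimML.pos_mul_atTop hpos hinv
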